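/- **Setting.** Let $M$ be either the light ray $\mathbb R$ (chiral case) or two-dimensional Minkowski space with coordinates $(t,x)$. *Regions* $O$ are the bounded nonempty open intervals, resp. the double cones $\{(t,x): t+x\in I,\ t-x\in J\}$ with $I,J$ bounded nonempty open intervals. A point $p$ is *left of* $q$ if $p<q$ (chiral case), resp. if $p$ and $q$ are spacelike separated and $p$ has the smaller $x$-coordinate. $S'$ denotes the (open) causal complement of $S$, i.e. the interior of the set of points that are left or right of each point of $S$; $W_L$ and $W_R$ are the left and right connected components of $O'$. For a family of local algebras $\mathcal N(O)$ on a Hilbert space and $S\subset M$, $\mathcal N(S)$ is the von Neumann algebra generated by all $\mathcal N(O)$ with $O\subset S$; a prime on an algebra is the commutant. The symmetry group is the proper orthochronous Poincaré group, resp. the group $x\mapsto e^{s}x+a$ that it induces on a light ray. Let $\mathcal A$ be an isotonous, local, Haag dual ($\mathcal A(O)=\mathcal A(O')'$) net of von Neumann algebras on a Hilbert space $\mathcal H$, with quasilocal C*-algebra also denoted $\mathcal A$. An endomorphism $\rho$ of $\mathcal A$ is *localized* in $O$ if it acts trivially on every $\mathcal A(O_1)$ with $O_1\subset O'$; it is *DHR*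 if it is a unital *-endomorphism localized in some region and for every region $O$ there is a unitary $u\in\mathcal A$ such that $\mathrm{Ad}_u\rho$ is localized in $O$. Let $(\theta,w,x)$ be a Q-system: $\theta$ is DHR, $w,x\in\mathcal A$, $wa=\theta(a)w$ and $x\theta(a)=\theta^2(a)x$ for $a\in\mathcal A$, $w^*x=\theta(w^*)x=1$, $xx=\theta(x)x$, $xx^*=\theta(x^*)x$, $w^*w=x^*x=d\cdot 1$ for some number $d$. The associated extension $\iota:\mathcal A\to\mathcal B$ is generated by $\iota(\mathcal A)$ and an element $v$ with $v^*=\iota(w^*x^*)v$, $vv=\iota(x)v$, $\iota(w^*)v=1$, $v\iota(a)=\iota(\theta(a))v$; it is considered in its vacuum representation on $\mathcal H$, $\iota(a)v\mapsto\theta(a)x$ (so $\iota=\theta$, $v=x$). Its local algebras are $\mathcal B(O)=\iota(\mathcal A(O))\,\iota(u)v$, where $u\in\mathcal A$ is any unitary such that $\mathrm{Ad}_u\theta$ is localized in $O$. $\mathcal A(O)$ is identified with $\iota(\mathcal A(O))$ when compared with $\mathcal B(O)$. For two families of local algebras on the same Hilbert space, $\mathcal B_1$ is *left-local* w.r.t.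 $\mathcal B_2$ if $\mathcal B_1(O_1)$ commutes with $\mathcal B_2(O_2)$ whenever $O_1$ lies in the left component of $O_2'$; $\mathcal B_1$ is *right-local* w.r.t. $\mathcal B_2$ if $\mathcal B_2$ is left-local w.r.t. $\mathcal B_1$. **Lemma.** Put $$\mathcal B^+_{\rm loc}(O):=\mathcal B(W_L)'\cap\mathcal B(W_R'),\qquad \mathcal B^-_{\rm loc}(O):=\mathcal B(W_R)'\cap\mathcal B(W_L').$$ (i) $\mathcal B^\pm_{\rm loc}$ are isotonous nets of von Neumann algebras, and they are covariant under every unitary representation of the symmetry group under which $\mathcal B$ is covariant. (ii) $\mathcal B$ is left-local w.r.t. $\mathcal B^+_{\rm loc}$ and right-local w.r.t. $\mathcal B^-_{\rm loc}$; equivalently, $\mathcal B^+_{\rm loc}$ is right-local and $\mathcal B^-_{\rm loc}$ is left-local w.r.t. $\mathcal B$. (iii) $\mathcal B^+_{\rm loc}$ and $\mathcal B^-_{\rm loc}$ are both local, and $\mathcal A(O)\subset\mathcal B^\pm_{\rm loc}(O)\subset\mathcal B(O)$ for every region $O$. In particular $\mathcal B^+_{\rm loc}(O)=\mathcal B(W_L)'\cap\mathcal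 B(O)$ and $\mathcal B^-_{\rm loc}(O)=\mathcal B(W_R)'\cap\mathcal B(O)$. (iv) They are maximal: if $\mathcal N(O)$ are von Neumann algebras with $\mathcal A(O)\subset\mathcal N(O)\subset\mathcal B(O)$ for all $O$, and $\mathcal B$ is left-local (resp. right-local) w.r.t. $\mathcal N$, then $\mathcal N(O)\subset\mathcal B^+_{\rm loc}(O)$ (resp. $\mathcal N(O)\subset\mathcal B^-_{\rm loc}(O)$) for all $O$. -/

import Mathlib

/-! ### The two spacetimes -/

/-- A one- or two-dimensional spacetime: its points, the relation that one point lies to the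
(spacelike) left of another, the bounded regions that index local algebras, and the group of
spacetime symmetries, which permutes these regions. Only the two spacetimes constructed below
are used. -/
structure Spacetime where
  Point : Type
  [topology : TopologicalSpace Point]
  leftOf : Point → Point → Prop
  IsRegion : Set Point → Prop
  Sym : Type
  [group : Group Sym]
  [action : MulAction Sym Point]
  isRegion_image : ∀ (g : Sym) (O : Set Point), IsRegion O → IsRegion ((fun p => g • p) '' O)

attribute [instance] Spacetime.topology Spacetime.group Spacetime.action

/-- An element of the group that the Poincaré group induces on a light ray: the map
`x ↦ e ^ s * x + a`, where boosts act as dilations. -/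
@[ext] structure RayPoincare where
  s : ℝ
  a : ℝ

namespace RayPoincare

noncomputable instance : Group RayPoincare where
  mul g h := ⟨g.s + h.s, Real.exp g.s * h.a + g.a⟩
  one := ⟨0, 0⟩
  inv g := ⟨-g.s, -(Real.exp (-g.s) * g.a)⟩
  mul_assoc g h k := by
    refine RayPoincare.ext (add_assoc _ _ _) ?_
    change Real.exp (g.s + h.s) * k.a + (Real.exp g.s * h.a + g.a)
      = Real.exp g.s * (Real.exp h.s * k.a + h.a) + g.a
    rw [Real.exp_add]; ring
  one_mul g := by
    refine RayPoincare.ext (zero_add _) ?_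
    change Real.exp 0 * g.a + 0 = g.a
    simp
  mul_one g := by
    refine RayPoincare.ext (add_zero _) ?_
    change Real.exp g.s * 0 + g.a = g.a
    simp
  inv_mul_cancel g := by
    refine RayPoincare.ext (neg_add_cancel _) ?_
    change Real.exp (-g.s) * g.a + -(Real.exp (-g.s) * g.a) = 0
    ring

noncomputable instance : MulAction RayPoincare ℝ where
  smul g x := Real.exp g.s * x + g.a
  one_smul x := by
    change Real.exp 0 * x + 0 = x
    simp
  mul_smul g h x := by
    change Real.exp (g.s + h.s) * x + (Real.exp g.s * h.a + g.a)
      = Real.exp g.s * (Real.exp h.s * x + h.a) + g.a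
    rw [Real.exp_add]; ring

theorem smul_def (g : RayPoincare) (x : ℝ) : g • x = Real.exp g.s * x + g.a := rfl

end RayPoincare

/-- The chiral case: the real line is a future-directed light ray, the regions are the bounded
nonempty open intervals, and left means past. -/
noncomputable def lightRay : Spacetime where
  Point := ℝ
  leftOf p q := p < q
  IsRegion O := ∃ a b : ℝ, a < b ∧ O = Set.Ioo a b
  Sym := RayPoincare
  isRegion_image := by
    rintro g O ⟨a, b, hab, rfl⟩
    have e : 0 < Real.exp g.s := Real.exp_pos _
    refine ⟨Real.exp g.s * a + g.a, Real.exp g.s * b + g.a, by nlinarith, ?_⟩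
    ext y
    simp only [Set.mem_image, Set.mem_Ioo, RayPoincare.smul_def]
    constructor
    · rintro ⟨x, ⟨h1, h2⟩, rfl⟩
      constructor <;> nlinarith
    · rintro ⟨h1, h2⟩
      refine ⟨(y - g.a) / Real.exp g.s, ⟨?_, ?_⟩, ?_⟩
      · rw [lt_div_iff₀ e]; nlinarith
      · rw [div_lt_iff₀ e]; nlinarith
      · field_simp; ring

/-- An element of the proper orthochronous Poincaré group of two-dimensional Minkowski space: a
boost with rapidity `s` followed by the translation by `(a, b)`. -/
@[ext] structure Poincare where
  s : ℝ
  a : ℝ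
  b : ℝ

namespace Poincare

noncomputable instance : Group Poincare where
  mul g h := ⟨g.s + h.s,
    Real.cosh g.s * h.a + Real.sinh g.s * h.b + g.a,
    Real.sinh g.s * h.a + Real.cosh g.s * h.b + g.b⟩
  one := ⟨0, 0, 0⟩
  inv g := ⟨-g.s,
    -(Real.cosh (-g.s) * g.a + Real.sinh (-g.s) * g.b),
    -(Real.sinh (-g.s) * g.a + Real.cosh (-g.s) * g.b)⟩
  mul_assoc g h k := by
    refine Poincare.ext (add_assoc _ _ _) ?_ ?_
    · change Real.cosh (g.s + h.s) * k.a + Real.sinh (g.s + h.s) * k.b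
          + (Real.cosh g.s * h.a + Real.sinh g.s * h.b + g.a)
        = Real.cosh g.s * (Real.cosh h.s * k.a + Real.sinh h.s * k.b + h.a)
          + Real.sinh g.s * (Real.sinh h.s * k.a + Real.cosh h.s * k.b + h.b) + g.a
      rw [Real.cosh_add, Real.sinh_add]; ring
    · change Real.sinh (g.s + h.s) * k.a + Real.cosh (g.s + h.s) * k.b
          + (Real.sinh g.s * h.a + Real.cosh g.s * h.b + g.b)
        = Real.sinh g.s * (Real.cosh h.s * k.a + Real.sinh h.s * k.b + h.a)
          + Real.cosh g.s * (Real.sinh h.s * k.a + Real.cosh h.s * k.b + h.b) + g.b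
      rw [Real.cosh_add, Real.sinh_add]; ring
  one_mul g := by
    refine Poincare.ext (zero_add _) ?_ ?_
    · change Real.cosh 0 * g.a + Real.sinh 0 * g.b + 0 = g.a
      simp
    · change Real.sinh 0 * g.a + Real.cosh 0 * g.b + 0 = g.b
      simp
  mul_one g := by
    refine Poincare.ext (add_zero _) ?_ ?_
    · change Real.cosh g.s * 0 + Real.sinh g.s * 0 + g.a = g.a
      simp
    · change Real.sinh g.s * 0 + Real.cosh g.s * 0 + g.b = g.b
      simp
  inv_mul_cancel g := by
    refine Poincare.ext (neg_add_cancel _) ?_ ?_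
    · change Real.cosh (-g.s) * g.a + Real.sinh (-g.s) * g.b
        + -(Real.cosh (-g.s) * g.a + Real.sinh (-g.s) * g.b) = 0
      ring
    · change Real.sinh (-g.s) * g.a + Real.cosh (-g.s) * g.b
        + -(Real.sinh (-g.s) * g.a + Real.cosh (-g.s) * g.b) = 0
      ring

noncomputable instance : MulAction Poincare (ℝ × ℝ) where
  smul g p := (Real.cosh g.s * p.1 + Real.sinh g.s * p.2 + g.a,
    Real.sinh g.s * p.1 + Real.cosh g.s * p.2 + g.b)
  one_smul p := by
    refine Prod.ext ?_ ?_
    · change Real.cosh 0 * p.1 + Real.sinh 0 * p.2 + 0 = p.1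
      simp
    · change Real.sinh 0 * p.1 + Real.cosh 0 * p.2 + 0 = p.2
      simp
  mul_smul g h p := by
    refine Prod.ext ?_ ?_
    · change Real.cosh (g.s + h.s) * p.1 + Real.sinh (g.s + h.s) * p.2
          + (Real.cosh g.s * h.a + Real.sinh g.s * h.b + g.a)
        = Real.cosh g.s * (Real.cosh h.s * p.1 + Real.sinh h.s * p.2 + h.a)
          + Real.sinh g.s * (Real.sinh h.s * p.1 + Real.cosh h.s * p.2 + h.b) + g.a
      rw [Real.cosh_add, Real.sinh_add]; ring
    · change Real.sinh (g.s + h.s) * p.1 + Real.cosh (g.s + h.s) * p.2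
          + (Real.sinh g.s * h.a + Real.cosh g.s * h.b + g.b)
        = Real.sinh g.s * (Real.cosh h.s * p.1 + Real.sinh h.s * p.2 + h.a)
          + Real.cosh g.s * (Real.sinh h.s * p.1 + Real.cosh h.s * p.2 + h.b) + g.b
      rw [Real.cosh_add, Real.sinh_add]; ring

theorem smul_def (g : Poincare) (p : ℝ × ℝ) :
    g • p = (Real.cosh g.s * p.1 + Real.sinh g.s * p.2 + g.a,
      Real.sinh g.s * p.1 + Real.cosh g.s * p.2 + g.b) := rfl

end Poincare

/-- The double cone `I × J = {(t, x) | t + x ∈ I, t - x ∈ J}` with `I = (a, b)`, `J = (c, d)`. -/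
def doubleCone (a b c d : ℝ) : Set (ℝ × ℝ) :=
  {p | p.1 + p.2 ∈ Set.Ioo a b ∧ p.1 - p.2 ∈ Set.Ioo c d}

theorem image_doubleCone (g : Poincare) (a b c d : ℝ) :
    (fun p : ℝ × ℝ => g • p) '' doubleCone a b c d
      = doubleCone (Real.exp g.s * a + (g.a + g.b)) (Real.exp g.s * b + (g.a + g.b))
          (Real.exp (-g.s) * c + (g.a - g.b)) (Real.exp (-g.s) * d + (g.a - g.b)) := by
  have key : ∀ (h : Poincare) (p : ℝ × ℝ),
      (h • p).1 + (h • p).2 = Real.exp h.s * (p.1 + p.2) + (h.a + h.b) ∧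
      (h • p).1 - (h • p).2 = Real.exp (-h.s) * (p.1 - p.2) + (h.a - h.b) := by
    intro h p
    rw [Poincare.smul_def, ← Real.cosh_add_sinh, ← Real.cosh_sub_sinh]
    constructor <;> ring
  have e1 : 0 < Real.exp g.s := Real.exp_pos _
  have e2 : 0 < Real.exp (-g.s) := Real.exp_pos _
  have main : ∀ p : ℝ × ℝ, p ∈ doubleCone a b c d ↔ g • p ∈
      doubleCone (Real.exp g.s * a + (g.a + g.b)) (Real.exp g.s * b + (g.a + g.b))
        (Real.exp (-g.s) * c + (g.a - g.b)) (Real.exp (-g.s) * d + (g.a - g.b)) := by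
    intro p
    simp only [doubleCone, Set.mem_ofPred_eq, (key g p).1, (key g p).2, Set.mem_Ioo,
      add_lt_add_iff_right, mul_lt_mul_iff_right₀ e1, mul_lt_mul_iff_right₀ e2]
  ext y
  constructor
  · rintro ⟨p, hp, rfl⟩
    exact (main p).1 hp
  · intro hy
    refine ⟨g⁻¹ • y, (main _).2 ?_, smul_inv_smul g y⟩
    rwa [smul_inv_smul]

/-- Two-dimensional Minkowski space with coordinates `(t, x)`: `p` lies to the spacelike left of
`q` if `p` and `q` are spacelike separated and `p` has the smaller space coordinate; the regions
are the double cones. -/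
noncomputable def minkowskiPlane : Spacetime where
  Point := ℝ × ℝ
  leftOf p q := (p.1 - q.1) ^ 2 < (p.2 - q.2) ^ 2 ∧ p.2 < q.2
  IsRegion O := ∃ a b c d : ℝ, a < b ∧ c < d ∧ O = doubleCone a b c d
  Sym := Poincare
  isRegion_image := by
    rintro g O ⟨a, b, c, d, hab, hcd, rfl⟩
    have e1 : 0 < Real.exp g.s := Real.exp_pos _
    have e2 : 0 < Real.exp (-g.s) := Real.exp_pos _
    exact ⟨_, _, _, _, by nlinarith, by nlinarith, image_doubleCone g a b c d⟩

/-- The two cases: chiral, and two-dimensional. -/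
inductive SpacetimeCase
  | chiral
  | twoDim

/-- The spacetime of each case. -/
noncomputable def SpacetimeCase.spacetime : SpacetimeCase → Spacetime
  | chiral => lightRay
  | twoDim => minkowskiPlane

namespace Spacetime

variable (M : Spacetime)

/-- The regions (intervals, resp. double cones) of a spacetime. -/
def Region : Type := {O : Set M.Point // M.IsRegion O}

variable {M}

/-- The image of a region under a spacetime symmetry. -/
def Region.map (g : M.Sym) (O : M.Region) : M.Region :=
  ⟨(fun p => g • p) '' O.1, M.isRegion_image g O.1 O.2⟩

/-- The (open) causal complement `S'`: points causally separated from all points of `S`. -/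
def causalCompl (S : Set M.Point) : Set M.Point :=
  interior {p | ∀ q ∈ S, M.leftOf p q ∨ M.leftOf q p}

/-- The left wedge `W_L` of `O`: the connected component of `O'` to the left of `O`. -/
def leftWedge (O : M.Region) : Set M.Point :=
  interior {p | ∀ q ∈ O.1, M.leftOf p q}

/-- The right wedge `W_R` of `O`: the connected component of `O'` to the right of `O`. -/
def rightWedge (O : M.Region) : Set M.Point :=
  interior {p | ∀ q ∈ O.1, M.leftOf q p}

end Spacetime

/-! ### Von Neumann algebras and nets -/

section Nets

variable {H : Type*} [NormedAddCommGroup H] [InnerProductSpace ℂ H] [CompleteSpace H]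

/-- The von Neumann algebra generated by a set of operators: the double commutant of
`S ∪ star S`. -/
noncomputable def vnGenerated (S : Set (H →L[ℂ] H)) : VonNeumannAlgebra H where
  toStarSubalgebra :=
    StarSubalgebra.centralizer ℂ (StarSubalgebra.centralizer ℂ S : Set (H →L[ℂ] H))
  centralizer_centralizer' := by
    change Set.centralizer (Set.centralizer
      ((StarSubalgebra.centralizer ℂ (StarSubalgebra.centralizer ℂ S : Set (H →L[ℂ] H)) :
        StarSubalgebra ℂ (H →L[ℂ] H)) : Set (H →L[ℂ] H))) = _
    rw [StarSubalgebra.coe_centralizer_centralizer, Set.centralizer_centralizer_centralizer]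
    exact (StarSubalgebra.coe_centralizer_centralizer ℂ S).symm

/-- The intersection of two von Neumann algebras on the same Hilbert space. -/
noncomputable def vnInter (N₁ N₂ : VonNeumannAlgebra H) : VonNeumannAlgebra H where
  toStarSubalgebra := N₁.toStarSubalgebra ⊓ N₂.toStarSubalgebra
  centralizer_centralizer' := by
    change Set.centralizer (Set.centralizer ((N₁ : Set (H →L[ℂ] H)) ∩ N₂)) = (N₁ : Set _) ∩ N₂
    refine Set.Subset.antisymm (Set.subset_inter ?_ ?_) Set.subset_centralizer_centralizer
    · calc _ ⊆ Set.centralizer (Set.centralizer (N₁ : Set (H →L[ℂ] H))) :=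
            Set.centralizer_subset (Set.centralizer_subset Set.inter_subset_left)
        _ = N₁ := N₁.centralizer_centralizer
    · calc _ ⊆ Set.centralizer (Set.centralizer (N₂ : Set (H →L[ℂ] H))) :=
            Set.centralizer_subset (Set.centralizer_subset Set.inter_subset_right)
        _ = N₂ := N₂.centralizer_centralizer

variable {M : Spacetime}

/-- The algebra `B(S)` of an arbitrary (possibly unbounded) set `S` of points: the von Neumann
algebra generated by the local algebras `B(O)` of all regions `O ⊆ S`. -/
noncomputable def algebraOf (B : M.Region → Set (H →L[ℂ] H)) (S : Set M.Point) :
    VonNeumannAlgebra H :=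
  vnGenerated (⋃ O : {O : M.Region // O.1 ⊆ S}, B O.1)

/-- Isotony: the algebras increase with the region. -/
def Isotonous (B : M.Region → Set (H →L[ℂ] H)) : Prop :=
  ∀ O₁ O₂ : M.Region, O₁.1 ⊆ O₂.1 → B O₁ ⊆ B O₂

/-- Locality: algebras of causally separated regions commute. -/
def Local (B : M.Region → Set (H →L[ℂ] H)) : Prop :=
  ∀ O₁ O₂ : M.Region, O₁.1 ⊆ Spacetime.causalCompl O₂.1 →
    ∀ b₁ ∈ B O₁, ∀ b₂ ∈ B O₂, b₁ * b₂ = b₂ * b₁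

/-- `B₁` is left-local with respect to `B₂`. -/
def LeftLocal (B₁ B₂ : M.Region → Set (H →L[ℂ] H)) : Prop :=
  ∀ O₁ O₂ : M.Region, O₁.1 ⊆ Spacetime.leftWedge O₂ →
    ∀ b₁ ∈ B₁ O₁, ∀ b₂ ∈ B₂ O₂, b₁ * b₂ = b₂ * b₁

/-- `B₁` is right-local with respect to `B₂`. -/
def RightLocal (B₁ B₂ : M.Region → Set (H →L[ℂ] H)) : Prop :=
  LeftLocal B₂ B₁

/-- Covariance with respect to a unitary representation `U` of the symmetry group:
`U(g) B(O) U(g)* = B(g O)`. -/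
def PoincareCovariant (U : M.Sym →* unitary (H →L[ℂ] H)) (B : M.Region → Set (H →L[ℂ] H)) : Prop :=
  ∀ (g : M.Sym) (O : M.Region),
    (fun b => (U g : H →L[ℂ] H) * b * star (U g : H →L[ℂ] H)) '' B O = B (O.map g)

/-- The family of underlying sets of a family of von Neumann algebras. -/
def asSets (N : M.Region → VonNeumannAlgebra H) : M.Region → Set (H →L[ℂ] H) :=
  fun O => (N O : Set (H →L[ℂ] H))

/-- `B_loc⁺(O) = B(W_L)' ∩ B(W_R')`. -/
noncomputable def locPlus (B : M.Region → Set (H →L[ℂ] H)) (O : M.Region) :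
    VonNeumannAlgebra H :=
  vnInter (algebraOf B (Spacetime.leftWedge O)).commutant
    (algebraOf B (Spacetime.causalCompl (Spacetime.rightWedge O)))

/-- `B_loc⁻(O) = B(W_R)' ∩ B(W_L')`. -/
noncomputable def locMinus (B : M.Region → Set (H →L[ℂ] H)) (O : M.Region) :
    VonNeumannAlgebra H :=
  vnInter (algebraOf B (Spacetime.rightWedge O)).commutant
    (algebraOf B (Spacetime.causalCompl (Spacetime.leftWedge O)))

/-- The family `N` is intermediate between `A` and `B`: `A(O) ⊆ N(O) ⊆ B(O)`. -/
def Intermediate (A B : M.Region → Set (H →L[ℂ] H)) (N : M.Region → VonNeumannAlgebra H) : Prop :=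
  ∀ O : M.Region, A O ⊆ N O ∧ (N O : Set (H →L[ℂ] H)) ⊆ B O

end Nets

/-! ### Haag dual nets, DHR endomorphisms, Q-systems and extensions -/

/-- A Haag dual net `A` of local von Neumann algebras in its defining (vacuum) representation. -/
structure HaagDualNet (M : Spacetime) (H : Type*) [NormedAddCommGroup H] [InnerProductSpace ℂ H]
    [CompleteSpace H] where
  alg : M.Region → VonNeumannAlgebra H
  isotonous : Isotonous (asSets alg)
  isLocal : Local (asSets alg)
  /-- Haag duality `A(O) = A(O')'`. -/
  duality : ∀ O : M.Region,
    alg O = (algebraOf (asSets alg) (Spacetime.causalCompl O.1)).commutant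

namespace HaagDualNet

variable {M : Spacetime} {H : Type*} [NormedAddCommGroup H] [InnerProductSpace ℂ H]
  [CompleteSpace H]

/-- The quasilocal C*-algebra: the norm closure of the union of all local algebras. -/
noncomputable def quasilocal (A : HaagDualNet M H) : StarSubalgebra ℂ (H →L[ℂ] H) :=
  (⨆ O : M.Region, (A.alg O).toStarSubalgebra).topologicalClosure

/-- A map `ρ` of the quasilocal algebra is localized in `O` if it acts trivially on the local
observables of the causal complement `O'`. -/
def LocalizedIn (A : HaagDualNet M H) (ρ : A.quasilocal → A.quasilocal) (O : M.Region) : Prop :=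
  ∀ O₁ : M.Region, O₁.1 ⊆ Spacetime.causalCompl O.1 →
    ∀ a : A.quasilocal, (a : H →L[ℂ] H) ∈ A.alg O₁ → ρ a = a

/-- `u` is a charge transporter taking `ρ` to `O`: it is unitary, and `Ad_u ρ` is localized
in `O`. -/
def Transports (A : HaagDualNet M H) (ρ : A.quasilocal → A.quasilocal) (u : A.quasilocal)
    (O : M.Region) : Prop :=
  u ∈ unitary A.quasilocal ∧ A.LocalizedIn (fun a => u * ρ a * star u) O

/-- A DHR endomorphism: a (unital) *-endomorphism of the quasilocal algebra which is localized in
some region and can be transported to every region. -/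
def IsDHR (A : HaagDualNet M H) (ρ : A.quasilocal →⋆ₐ[ℂ] A.quasilocal) : Prop :=
  (∃ O : M.Region, A.LocalizedIn ρ O) ∧ ∀ O : M.Region, ∃ u : A.quasilocal, A.Transports ρ u O

/-- A Q-system `(θ, w, x)` of dimension `d` in the category of DHR endomorphisms: intertwiners
`w : id → θ` and `x : θ → θ²` with the unit, associativity, Frobenius and standardness
properties. -/
structure QSystem (A : HaagDualNet M H) where
  θ : A.quasilocal →⋆ₐ[ℂ] A.quasilocal
  w : A.quasilocal
  x : A.quasilocal
  d : ℝ
  isDHR : A.IsDHR θ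
  w_intertwines : ∀ a, w * a = θ a * w
  x_intertwines : ∀ a, x * θ a = θ (θ a) * x
  unit_left : star w * x = 1
  unit_right : θ (star w) * x = 1
  associative : x * x = θ x * x
  frobenius : x * star x = θ (star x) * x
  standard_w : star w * w = (d : ℂ) • (1 : A.quasilocal)
  standard_x : star x * x = (d : ℂ) • (1 : A.quasilocal)

namespace QSystem

variable {A : HaagDualNet M H} (Q : A.QSystem)

/-- The observables inside the extension, `ι(A(O))`. The extension `B` is the algebra generated by
`ι(A)` and one element `v` with the relations `v* = ι(w* x*) v`, `v v = ι(x) v`, `ι(w*) v = 1`,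
`v ι(a) = ι(θ(a)) v`; it is taken in its vacuum representation `ι(a) v ↦ θ(a) x`, in which
`ι = θ` and `v = x`. -/
def observables (O : M.Region) : Set (H →L[ℂ] H) :=
  {b | ∃ a : A.quasilocal, (a : H →L[ℂ] H) ∈ A.alg O ∧ b = (Q.θ a : H →L[ℂ] H)}

/-- The local algebras of the extension, `B(O) = ι(A(O)) v̂` with `v̂ = ι(u) v`, where `u` is a
unitary such that `Ad_u θ` is localized in `O`. By Haag duality the set is the same for every such
`u`. -/
def extension (O : M.Region) : Set (H →L[ℂ] H) :=
  {b | ∃ u : A.quasilocal, A.Transports Q.θ u O ∧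
    ∃ a : A.quasilocal, (a : H →L[ℂ] H) ∈ A.alg O ∧
      b = ((Q.θ a * (Q.θ u * Q.x) : A.quasilocal) : H →L[ℂ] H)}

/-- The defining relations of the extension hold for `ι = θ`, `v = x`. -/
theorem relations : star Q.x = Q.θ (star Q.w * star Q.x) * Q.x ∧ Q.x * Q.x = Q.θ Q.x * Q.x ∧
    Q.θ (star Q.w) * Q.x = 1 ∧ (∀ a, Q.x * Q.θ a = Q.θ (Q.θ a) * Q.x) ∧
    ∀ a, Q.θ a * Q.x = 0 → a = 0 := by
  refine ⟨?_, Q.associative, Q.unit_right, Q.x_intertwines, ?_⟩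
  · rw [map_mul, mul_assoc, ← Q.frobenius, ← mul_assoc, Q.unit_right, one_mul]
  · intro a ha
    have h1 : star Q.w * Q.θ a = a * star Q.w := by
      have h := congrArg star (Q.w_intertwines (star a))
      simp only [star_mul, star_star, map_star] at h
      exact h.symm
    calc a = a * (star Q.w * Q.x) := by rw [Q.unit_left, mul_one]
      _ = star Q.w * (Q.θ a * Q.x) := by rw [← mul_assoc, ← h1, mul_assoc]
      _ = 0 := by rw [ha, mul_zero]

end QSystem

end HaagDualNet

/-! The one substantial point is the inclusion `B_loc^±(O) ⊆ B(O)`. The rest is formal: isotony and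
covariance come from monotonicity and equivariance of wedges, one-sided locality is built into the
commutant of `B(W_L)` or `B(W_R)`, and maximality only uses `B(O) ⊆ B(W_R')` or `B(O) ⊆ B(W_L')`.

For the inclusion, `mem_extension_iff` describes `B(O)` without transporters: it consists of the
quasilocal `b` that commute with `θ(A(O₁))` for all `O₁ ⊆ O'` and satisfy `θ(b) x = x b`. Let `b`
lie in `B(W_L)' ∩ B(W_R')`. It commutes with observables on the left because these lie in `B(W_L)`,
and with observables on the right because these commute with `B(W_R')`. If `u` transports `θ` to
`O`, Haag duality puts `u b u*` in `A(O)`, so `b` is quasilocal and `θ(b)` makes sense.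

The equation `θ(b) x = x b` does not pass directly to the weak closure defining `B(W_R')`, since `θ`
is not assumed normal. Choose `v` transporting `θ` to some `R ⊆ W_R`. Then `v θ(c) = c v` for `c ∈
A(O)`, and `apply_mul_x_iff` turns the equation into commutation with the single operator `z = u* v
θ(u) x`. The same `z` serves every region `K ⊇ O` in `W_R'`, and each region of `W_R'` lies in such
a `K`. Hence `z` is in the commutant of `B(W_R')`, so `b` commutes with `z`. The minus case
exchanges left and right. `IsCausal` isolates the geometry this needs. -/

/-! ### Causal geometry -/

namespace Spacetime

/-- The geometric facts about regions, wedges and symmetries that hold in both spacetimes. -/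
structure IsCausal (M : Spacetime) : Prop where
  isOpen_region : ∀ O : M.Region, IsOpen O.1
  subset_wedge : ∀ O₁ O₂ : M.Region, O₁.1 ⊆ causalCompl O₂.1 →
    O₁.1 ⊆ leftWedge O₂ ∨ O₁.1 ⊆ rightWedge O₂
  exists_left : ∀ O : M.Region, ∃ R : M.Region, R.1 ⊆ leftWedge O
  exists_right : ∀ O : M.Region, ∃ R : M.Region, R.1 ⊆ rightWedge O
  directed_left : ∀ O P : M.Region, P.1 ⊆ causalCompl (leftWedge O) →
    ∃ K : M.Region, O.1 ⊆ K.1 ∧ P.1 ⊆ K.1 ∧ K.1 ⊆ causalCompl (leftWedge O)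
  directed_right : ∀ O P : M.Region, P.1 ⊆ causalCompl (rightWedge O) →
    ∃ K : M.Region, O.1 ⊆ K.1 ∧ P.1 ⊆ K.1 ∧ K.1 ⊆ causalCompl (rightWedge O)
  leftOf_smul : ∀ (g : M.Sym) (p q : M.Point), M.leftOf (g • p) (g • q) ↔ M.leftOf p q
  continuous_smul : ∀ g : M.Sym, Continuous fun p : M.Point => g • p

/-! ### Causal complements, wedges and their images under symmetries. -/

section General

variable {M : Spacetime}

theorem causalCompl_anti {S T : Set M.Point} (h : S ⊆ T) : causalCompl T ⊆ causalCompl S :=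
  interior_mono fun _ hp q hq => hp q (h hq)

theorem leftWedge_anti {O₁ O₂ : M.Region} (h : O₁.1 ⊆ O₂.1) : leftWedge O₂ ⊆ leftWedge O₁ :=
  interior_mono fun _ hp q hq => hp q (h hq)

theorem rightWedge_anti {O₁ O₂ : M.Region} (h : O₁.1 ⊆ O₂.1) : rightWedge O₂ ⊆ rightWedge O₁ :=
  interior_mono fun _ hp q hq => hp q (h hq)

theorem leftWedge_subset_causalCompl (O : M.Region) : leftWedge O ⊆ causalCompl O.1 :=
  interior_mono fun _ hp q hq => Or.inl (hp q hq)

theorem rightWedge_subset_causalCompl (O : M.Region) : rightWedge O ⊆ causalCompl O.1 :=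
  interior_mono fun _ hp q hq => Or.inr (hp q hq)

theorem subset_causalCompl_iff {S T : Set M.Point} (hS : IsOpen S) :
    S ⊆ causalCompl T ↔ ∀ p ∈ S, ∀ q ∈ T, M.leftOf p q ∨ M.leftOf q p :=
  hS.subset_interior_iff

theorem subset_causalCompl_comm {S T : Set M.Point} (hS : IsOpen S) (hT : IsOpen T) :
    S ⊆ causalCompl T ↔ T ⊆ causalCompl S := by
  rw [subset_causalCompl_iff hS, subset_causalCompl_iff hT]
  exact ⟨fun h p hp q hq => (h q hq p hp).symm, fun h p hp q hq => (h q hq p hp).symm⟩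

namespace IsCausal

/-- Regions are open, so both interiors can be dropped and only the order of two universal
quantifiers differs. This converts left into right locality. -/
theorem subset_leftWedge_iff (hM : M.IsCausal) (O₁ O₂ : M.Region) :
    O₁.1 ⊆ leftWedge O₂ ↔ O₂.1 ⊆ rightWedge O₁ := by
  rw [leftWedge, rightWedge, (hM.isOpen_region O₁).subset_interior_iff,
    (hM.isOpen_region O₂).subset_interior_iff]
  exact ⟨fun h p hp q hq => h hq p hp, fun h p hp q hq => h hq p hp⟩

theorem subset_compl_rightWedge (hM : M.IsCausal) (O : M.Region) :
    O.1 ⊆ causalCompl (rightWedge O) :=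
  (subset_causalCompl_comm isOpen_interior (hM.isOpen_region O)).1
    (rightWedge_subset_causalCompl O)

theorem subset_compl_leftWedge (hM : M.IsCausal) (O : M.Region) :
    O.1 ⊆ causalCompl (leftWedge O) :=
  (subset_causalCompl_comm isOpen_interior (hM.isOpen_region O)).1
    (leftWedge_subset_causalCompl O)

theorem image_interior_smul (hM : M.IsCausal) (g : M.Sym) (S : Set M.Point) :
    (fun p => g • p) '' interior S = interior ((fun p => g • p) '' S) :=
  Homeomorph.image_interior
    { toEquiv := MulAction.toPerm g
      continuous_toFun := hM.continuous_smul g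
      continuous_invFun := hM.continuous_smul g⁻¹ } S

theorem image_forall_smul (r : M.Point → M.Point → Prop) (g : M.Sym)
    (hr : ∀ p q, r (g • p) (g • q) ↔ r p q) (S : Set M.Point) :
    (fun p => g • p) '' {p | ∀ q ∈ S, r p q} = {p | ∀ q ∈ (fun p => g • p) '' S, r p q} := by
  ext y
  constructor
  · rintro ⟨p, hp, rfl⟩ _ ⟨q, hq, rfl⟩
    exact (hr p q).2 (hp q hq)
  · intro hy
    refine ⟨g⁻¹ • y, fun q hq => ?_, smul_inv_smul g y⟩
    rw [← hr, smul_inv_smul]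
    exact hy _ ⟨q, hq, rfl⟩

theorem image_causalCompl (hM : M.IsCausal) (g : M.Sym) (S : Set M.Point) :
    (fun p => g • p) '' causalCompl S = causalCompl ((fun p => g • p) '' S) := by
  rw [causalCompl, hM.image_interior_smul,
    image_forall_smul (fun p q => M.leftOf p q ∨ M.leftOf q p) g
      (fun p q => or_congr (hM.leftOf_smul g p q) (hM.leftOf_smul g q p)), causalCompl]

theorem image_leftWedge (hM : M.IsCausal) (g : M.Sym) (O : M.Region) :
    (fun p => g • p) '' leftWedge O = leftWedge (O.map g) := by
  rw [leftWedge, hM.image_interior_smul, image_forall_smul M.leftOf g (hM.leftOf_smul g)]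
  rfl

theorem image_rightWedge (hM : M.IsCausal) (g : M.Sym) (O : M.Region) :
    (fun p => g • p) '' rightWedge O = rightWedge (O.map g) := by
  rw [rightWedge, hM.image_interior_smul,
    image_forall_smul (fun p q => M.leftOf q p) g (fun p q => hM.leftOf_smul g q p)]
  rfl

end IsCausal

theorem Region.map_inv_map (g : M.Sym) (O : M.Region) : (O.map g).map g⁻¹ = O := by
  apply Subtype.ext
  change (fun p => g⁻¹ • p) '' ((fun p => g • p) '' O.1) = O.1
  simp [Set.image_image]

end General

/-! ### The light ray. -/

theorem exists_common_of_lt {a b a' b' : ℝ} (hab : a < b) (hab' : a' < b') (h : a < b')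
    (h' : a' < b) : ∃ r, r ∈ Set.Ioo a b ∧ r ∈ Set.Ioo a' b' := by
  obtain ⟨r, hr1, hr2⟩ := exists_between
    (show max a a' < min b b' from max_lt (lt_min hab h) (lt_min h' hab'))
  rw [max_lt_iff] at hr1
  rw [lt_min_iff] at hr2
  exact ⟨r, ⟨hr1.1, hr2.1⟩, hr1.2, hr2.2⟩

/-- A bounded open interval, as a set of points of the light ray. -/
abbrev openInterval (a b : ℝ) : Set ℝ := Set.Ioo a b

theorem openInterval_subset {a b a' b' : ℝ} (ha : a' ≤ a) (hb : b ≤ b') :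
    openInterval a b ⊆ openInterval a' b' :=
  Set.Ioo_subset_Ioo ha hb

/-- With the converse `lightRay_of_mem_leftWedge`, which gives only `≤`, this fixes the wedge up to
its boundary point. That suffices, and the interior need not be computed. -/
theorem lightRay_mem_leftWedge {a b : ℝ} (h : lightRay.IsRegion (openInterval a b)) {p : ℝ}
    (hp : p < a) : p ∈ leftWedge (M := lightRay) ⟨openInterval a b, h⟩ := by
  have hs : Set.Iio a ⊆ {p : ℝ | ∀ q ∈ Set.Ioo a b, p < q} := fun p hp q hq => hp.trans hq.1
  exact interior_maximal hs isOpen_Iio hp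

theorem lightRay_mem_rightWedge {a b : ℝ} (h : lightRay.IsRegion (openInterval a b)) {p : ℝ}
    (hp : b < p) : p ∈ rightWedge (M := lightRay) ⟨openInterval a b, h⟩ := by
  have hs : Set.Ioi b ⊆ {p : ℝ | ∀ q ∈ Set.Ioo a b, q < p} := fun p hp q hq => hq.2.trans hp
  exact interior_maximal hs isOpen_Ioi hp

theorem lightRay_of_mem_leftWedge {a b : ℝ} (hab : a < b) (h : lightRay.IsRegion (openInterval a b))
    {p : ℝ} (hp : p ∈ leftWedge (M := lightRay) ⟨openInterval a b, h⟩) : p ≤ a := by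
  have hp' : ∀ q ∈ Set.Ioo a b, p < q := interior_subset hp
  by_contra! hc
  obtain ⟨r, hr1, hr2⟩ := exists_between (lt_min hc hab)
  rw [lt_min_iff] at hr2
  exact lt_asymm hr2.1 (hp' r ⟨hr1, hr2.2⟩)

theorem lightRay_of_mem_rightWedge {a b : ℝ} (hab : a < b) (h : lightRay.IsRegion (openInterval a b))
    {p : ℝ} (hp : p ∈ rightWedge (M := lightRay) ⟨openInterval a b, h⟩) : b ≤ p := by
  have hp' : ∀ q ∈ Set.Ioo a b, q < p := interior_subset hp
  by_contra! hc
  obtain ⟨r, hr1, hr2⟩ := exists_between (max_lt hc hab)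
  rw [max_lt_iff] at hr1
  exact lt_asymm hr1.1 (hp' r ⟨hr1.2, hr2⟩)

theorem lightRay_subset_causalCompl_iff {a b : ℝ} {S : Set ℝ} :
    openInterval a b ⊆ causalCompl (M := lightRay) S ↔ ∀ p ∈ Set.Ioo a b, ∀ q ∈ S, p < q ∨ q < p :=
  subset_causalCompl_iff (M := lightRay) (isOpen_Ioo (α := ℝ))

theorem lightRay_isCausal : lightRay.IsCausal where
  isOpen_region := by
    rintro ⟨_, a, b, -, rfl⟩
    exact isOpen_Ioo (α := ℝ)
  subset_wedge := by
    rintro ⟨_, a, b, hab, rfl⟩ ⟨_, a', b', hab', rfl⟩ h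
    have h' := lightRay_subset_causalCompl_iff.1 h
    have : b ≤ a' ∨ b' ≤ a := by
      by_contra! hc
      obtain ⟨p, hp, hp'⟩ := exists_common_of_lt hab hab' hc.2 hc.1
      exact lt_irrefl p ((h' p hp p hp').elim id id)
    rcases this with hba | hba
    · exact Or.inl fun p hp =>
        interior_maximal (s := {p : ℝ | ∀ q ∈ Set.Ioo a' b', p < q}) (t := Set.Ioo a b)
          (fun p hp q hq => (hp.2.trans_le hba).trans hq.1) isOpen_Ioo hp
    · exact Or.inr fun p hp =>
        interior_maximal (s := {p : ℝ | ∀ q ∈ Set.Ioo a' b', q < p}) (t := Set.Ioo a b)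
          (fun p hp q hq => (hq.2.trans_le hba).trans hp.1) isOpen_Ioo hp
  exists_left := by
    rintro ⟨_, a, b, hab, rfl⟩
    exact ⟨⟨openInterval (a - 1) a, _, _, by linarith, rfl⟩,
      fun p hp => lightRay_mem_leftWedge _ hp.2⟩
  exists_right := by
    rintro ⟨_, a, b, hab, rfl⟩
    exact ⟨⟨openInterval b (b + 1), _, _, by linarith, rfl⟩,
      fun p hp => lightRay_mem_rightWedge _ hp.1⟩
  directed_left := by
    rintro ⟨_, a, b, hab, rfl⟩ ⟨_, a', b', hab', rfl⟩ h
    have h' := lightRay_subset_causalCompl_iff.1 h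
    -- Otherwise some point of the second interval lies in the left wedge and would be causally
    -- separated from itself.
    have haa : a ≤ a' := by
      by_contra! hc
      obtain ⟨p, hp1, hp2⟩ := exists_between (lt_min hc hab')
      rw [lt_min_iff] at hp2
      exact lt_irrefl p
        ((h' p ⟨hp1, hp2.2⟩ p (lightRay_mem_leftWedge _ hp2.1)).elim id id)
    -- The hull of both intervals: it grows only at the end away from the wedge.
    refine ⟨⟨openInterval a (max b b'), _, _, hab.trans_le (le_max_left _ _), rfl⟩,
      openInterval_subset le_rfl (le_max_left _ _), openInterval_subset haa (le_max_right _ _), ?_⟩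
    exact lightRay_subset_causalCompl_iff.2
      fun p hp q hq => Or.inr ((lightRay_of_mem_leftWedge hab _ hq).trans_lt hp.1)
  directed_right := by
    rintro ⟨_, a, b, hab, rfl⟩ ⟨_, a', b', hab', rfl⟩ h
    have h' := lightRay_subset_causalCompl_iff.1 h
    have hbb : b' ≤ b := by
      by_contra! hc
      obtain ⟨p, hp1, hp2⟩ := exists_between (max_lt hc hab')
      rw [max_lt_iff] at hp1
      exact lt_irrefl p
        ((h' p ⟨hp1.2, hp2⟩ p (lightRay_mem_rightWedge _ hp1.1)).elim id id)
    refine ⟨⟨openInterval (min a a') b, _, _, (min_le_left _ _).trans_lt hab, rfl⟩,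
      openInterval_subset (min_le_left _ _) le_rfl, openInterval_subset (min_le_right _ _) hbb, ?_⟩
    exact lightRay_subset_causalCompl_iff.2
      fun p hp q hq => Or.inl (hp.2.trans_le (lightRay_of_mem_rightWedge hab _ hq))
  leftOf_smul := by
    intro (g : RayPoincare) (p : ℝ) (q : ℝ)
    change Real.exp g.s * p + g.a < Real.exp g.s * q + g.a ↔ p < q
    rw [add_lt_add_iff_right, mul_lt_mul_iff_right₀ (Real.exp_pos _)]
  continuous_smul := by
    intro g
    change Continuous fun p : ℝ => Real.exp g.s * p + g.a
    fun_prop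

/-! ### The Minkowski plane in light-cone coordinates. -/

/-- The interval form factors into `t + x` and `t - x`, so the relation is a product of two strict
orders, the second reversed. Each later argument then reduces to intervals in one coordinate. -/
theorem minkowskiPlane_leftOf_iff (p q : ℝ × ℝ) :
    minkowskiPlane.leftOf p q ↔ p.1 + p.2 < q.1 + q.2 ∧ q.1 - q.2 < p.1 - p.2 := by
  change (p.1 - q.1) ^ 2 < (p.2 - q.2) ^ 2 ∧ p.2 < q.2 ↔ _
  constructor
  · rintro ⟨h1, h2⟩
    have h := abs_lt.1 (sq_lt_sq.1 h1)
    rw [abs_of_neg (sub_neg.2 h2)] at h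
    constructor <;> linarith [h.1, h.2]
  · rintro ⟨h1, h2⟩
    have h : p.2 < q.2 := by linarith
    refine ⟨sq_lt_sq.2 ?_, h⟩
    rw [abs_of_neg (sub_neg.2 h), abs_lt]
    constructor <;> linarith

theorem isOpen_doubleCone (a b c d : ℝ) : IsOpen (doubleCone a b c d) :=
  (isOpen_Ioo.preimage (continuous_fst.add continuous_snd)).inter
    (isOpen_Ioo.preimage (continuous_fst.sub continuous_snd))

/-- The point with light-cone coordinates `t + x = r`, `t - x = s`. -/
noncomputable def lightConePoint (r s : ℝ) : ℝ × ℝ := ((r + s) / 2, (r - s) / 2)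

theorem lightConePoint_add (r s : ℝ) : (lightConePoint r s).1 + (lightConePoint r s).2 = r := by
  simp only [lightConePoint]; ring

theorem lightConePoint_sub (r s : ℝ) : (lightConePoint r s).1 - (lightConePoint r s).2 = s := by
  simp only [lightConePoint]; ring

theorem minkowskiPlane_leftOf_lightConePoint (r s r' s' : ℝ) :
    minkowskiPlane.leftOf (lightConePoint r s) (lightConePoint r' s') ↔ r < r' ∧ s' < s := by
  rw [minkowskiPlane_leftOf_iff, lightConePoint_add, lightConePoint_sub, lightConePoint_add,
    lightConePoint_sub]

theorem lightConePoint_mem {a b c d r s : ℝ} (hr : r ∈ Set.Ioo a b) (hs : s ∈ Set.Ioo c d) :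
    lightConePoint r s ∈ doubleCone a b c d := by
  refine ⟨?_, ?_⟩
  · rwa [lightConePoint_add]
  · rwa [lightConePoint_sub]

theorem doubleCone_mono {a b c d a' b' c' d' : ℝ} (ha : a' ≤ a) (hb : b ≤ b') (hc : c' ≤ c)
    (hd : d ≤ d') : doubleCone a b c d ⊆ doubleCone a' b' c' d' :=
  fun _ hp => ⟨Set.Ioo_subset_Ioo ha hb hp.1, Set.Ioo_subset_Ioo hc hd hp.2⟩

theorem minkowskiPlane_mem_leftWedge {a b c d : ℝ} (h : minkowskiPlane.IsRegion
    (doubleCone a b c d)) {p : ℝ × ℝ} (h1 : p.1 + p.2 < a) (h2 : d < p.1 - p.2) :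
    p ∈ leftWedge (M := minkowskiPlane) ⟨doubleCone a b c d, h⟩ := by
  have hs : {p : ℝ × ℝ | p.1 + p.2 < a ∧ d < p.1 - p.2} ⊆
      {p : ℝ × ℝ | ∀ q ∈ doubleCone a b c d, minkowskiPlane.leftOf p q} := fun p hp q hq =>
    (minkowskiPlane_leftOf_iff p q).2 ⟨hp.1.trans hq.1.1, hq.2.2.trans hp.2⟩
  refine interior_maximal hs ?_ ⟨h1, h2⟩
  exact (isOpen_lt (continuous_fst.add continuous_snd) continuous_const).inter
      (isOpen_lt continuous_const (continuous_fst.sub continuous_snd))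

theorem minkowskiPlane_mem_rightWedge {a b c d : ℝ} (h : minkowskiPlane.IsRegion
    (doubleCone a b c d)) {p : ℝ × ℝ} (h1 : b < p.1 + p.2) (h2 : p.1 - p.2 < c) :
    p ∈ rightWedge (M := minkowskiPlane) ⟨doubleCone a b c d, h⟩ := by
  have hs : {p : ℝ × ℝ | b < p.1 + p.2 ∧ p.1 - p.2 < c} ⊆
      {p : ℝ × ℝ | ∀ q ∈ doubleCone a b c d, minkowskiPlane.leftOf q p} := fun p hp q hq =>
    (minkowskiPlane_leftOf_iff q p).2 ⟨hq.1.2.trans hp.1, hp.2.trans hq.2.1⟩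
  refine interior_maximal hs ?_ ⟨h1, h2⟩
  exact (isOpen_lt continuous_const (continuous_fst.add continuous_snd)).inter
      (isOpen_lt (continuous_fst.sub continuous_snd) continuous_const)

theorem minkowskiPlane_of_mem_leftWedge {a b c d : ℝ} (hab : a < b) (hcd : c < d)
    (h : minkowskiPlane.IsRegion (doubleCone a b c d)) {p : ℝ × ℝ}
    (hp : p ∈ leftWedge (M := minkowskiPlane) ⟨doubleCone a b c d, h⟩) :
    p.1 + p.2 ≤ a ∧ d ≤ p.1 - p.2 := by
  have hp' : ∀ q ∈ doubleCone a b c d, minkowskiPlane.leftOf p q := interior_subset hp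
  have key : ∀ r ∈ Set.Ioo a b, ∀ s ∈ Set.Ioo c d, p.1 + p.2 < r ∧ s < p.1 - p.2 := by
    intro r hr s hs
    have := (minkowskiPlane_leftOf_iff _ _).1 (hp' _ (lightConePoint_mem hr hs))
    rwa [lightConePoint_add, lightConePoint_sub] at this
  constructor
  · by_contra! hc
    obtain ⟨s, hs⟩ := exists_between hcd
    obtain ⟨r, hr1, hr2⟩ := exists_between (lt_min hc hab)
    rw [lt_min_iff] at hr2
    exact lt_asymm hr2.1 (key r ⟨hr1, hr2.2⟩ s hs).1
  · by_contra! hc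
    obtain ⟨r, hr⟩ := exists_between hab
    obtain ⟨s, hs1, hs2⟩ := exists_between (max_lt hc hcd)
    rw [max_lt_iff] at hs1
    exact lt_asymm hs1.1 (key r hr s ⟨hs1.2, hs2⟩).2

theorem minkowskiPlane_of_mem_rightWedge {a b c d : ℝ} (hab : a < b) (hcd : c < d)
    (h : minkowskiPlane.IsRegion (doubleCone a b c d)) {p : ℝ × ℝ}
    (hp : p ∈ rightWedge (M := minkowskiPlane) ⟨doubleCone a b c d, h⟩) :
    b ≤ p.1 + p.2 ∧ p.1 - p.2 ≤ c := by
  have hp' : ∀ q ∈ doubleCone a b c d, minkowskiPlane.leftOf q p := interior_subset hp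
  have key : ∀ r ∈ Set.Ioo a b, ∀ s ∈ Set.Ioo c d, r < p.1 + p.2 ∧ p.1 - p.2 < s := by
    intro r hr s hs
    have := (minkowskiPlane_leftOf_iff _ _).1 (hp' _ (lightConePoint_mem hr hs))
    rwa [lightConePoint_add, lightConePoint_sub] at this
  constructor
  · by_contra! hc
    obtain ⟨s, hs⟩ := exists_between hcd
    obtain ⟨r, hr1, hr2⟩ := exists_between (max_lt hc hab)
    rw [max_lt_iff] at hr1
    exact lt_asymm hr1.1 (key r ⟨hr1.2, hr2⟩ s hs).1
  · by_contra! hc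
    obtain ⟨r, hr⟩ := exists_between hab
    obtain ⟨s, hs1, hs2⟩ := exists_between (lt_min hc hcd)
    rw [lt_min_iff] at hs2
    exact lt_asymm hs2.1 (key r hr s ⟨hs1, hs2.2⟩).2

theorem minkowskiPlane_isCausal : minkowskiPlane.IsCausal where
  isOpen_region := by
    rintro ⟨_, a, b, c, d, -, -, rfl⟩
    exact isOpen_doubleCone a b c d
  subset_wedge := by
    rintro ⟨_, a, b, c, d, hab, hcd, rfl⟩ ⟨_, a', b', c', d', hab', hcd', rfl⟩ h
    have h' := (subset_causalCompl_iff (M := minkowskiPlane) (isOpen_doubleCone a b c d)).1 h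
    have key : ∀ r ∈ Set.Ioo a b, ∀ s ∈ Set.Ioo c d, ∀ r' ∈ Set.Ioo a' b', ∀ s' ∈ Set.Ioo c' d',
        (r < r' ∧ s' < s) ∨ (r' < r ∧ s < s') := by
      intro r hr s hs r' hr' s' hs'
      have := h' _ (lightConePoint_mem hr hs) _ (lightConePoint_mem hr' hs')
      rwa [minkowskiPlane_leftOf_lightConePoint, minkowskiPlane_leftOf_lightConePoint] at this
    obtain ⟨r, hr⟩ := exists_between hab
    obtain ⟨s, hs⟩ := exists_between hcd
    obtain ⟨r', hr'⟩ := exists_between hab'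
    obtain ⟨s', hs'⟩ := exists_between hcd'
    have hplus : b ≤ a' ∨ b' ≤ a := by
      by_contra! hc
      obtain ⟨r, hr, hr'⟩ := exists_common_of_lt hab hab' hc.2 hc.1
      rcases key r hr s hs r hr' s' hs' with h | h <;> exact lt_irrefl _ h.1
    have hminus : d ≤ c' ∨ d' ≤ c := by
      by_contra! hc
      obtain ⟨s, hs, hs'⟩ := exists_common_of_lt hcd hcd' hc.2 hc.1
      rcases key r hr s hs r' hr' s hs' with h | h <;> exact lt_irrefl _ h.2
    -- Each coordinate is separated on its own; one sample pair of points forces both separations to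
    -- the same side.
    have k := key r hr s hs r' hr' s' hs'
    obtain ⟨hr1, hr2⟩ := hr
    obtain ⟨hs1, hs2⟩ := hs
    obtain ⟨hr1', hr2'⟩ := hr'
    obtain ⟨hs1', hs2'⟩ := hs'
    rcases k with k | k
    · have h1 : b ≤ a' := hplus.resolve_right fun h => by linarith [k.1]
      have h2 : d' ≤ c := hminus.resolve_left fun h => by linarith [k.2]
      exact Or.inl fun p hp =>
        minkowskiPlane_mem_leftWedge _ (hp.1.2.trans_le h1) (h2.trans_lt hp.2.1)
    · have h1 : b' ≤ a := hplus.resolve_left fun h => by linarith [k.1]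
      have h2 : d ≤ c' := hminus.resolve_right fun h => by linarith [k.2]
      exact Or.inr fun p hp =>
        minkowskiPlane_mem_rightWedge _ (h1.trans_lt hp.1.1) (hp.2.2.trans_le h2)
  exists_left := by
    rintro ⟨_, a, b, c, d, hab, hcd, rfl⟩
    exact ⟨⟨doubleCone (a - 1) a d (d + 1), _, _, _, _, by linarith, by linarith, rfl⟩,
      fun p hp => minkowskiPlane_mem_leftWedge _ hp.1.2 hp.2.1⟩
  exists_right := by
    rintro ⟨_, a, b, c, d, hab, hcd, rfl⟩
    exact ⟨⟨doubleCone b (b + 1) (c - 1) c, _, _, _, _, by linarith, by linarith, rfl⟩,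
      fun p hp => minkowskiPlane_mem_rightWedge _ hp.1.1 hp.2.2⟩
  directed_left := by
    rintro ⟨_, a, b, c, d, hab, hcd, rfl⟩ ⟨_, a', b', c', d', hab', hcd', rfl⟩ h
    have h' := (subset_causalCompl_iff (M := minkowskiPlane)
      (isOpen_doubleCone a' b' c' d')).1 h
    have key : ∀ r ∈ Set.Ioo a' b', ∀ s ∈ Set.Ioo c' d', ∀ r' < a, ∀ s' > d,
        (r < r' ∧ s' < s) ∨ (r' < r ∧ s < s') := by
      intro r hr s hs r' hr' s' hs'
      have := h' _ (lightConePoint_mem hr hs) (lightConePoint r' s')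
        (minkowskiPlane_mem_leftWedge _ (by rwa [lightConePoint_add])
          (by rwa [lightConePoint_sub]))
      rwa [minkowskiPlane_leftOf_lightConePoint, minkowskiPlane_leftOf_lightConePoint] at this
    have haa : a ≤ a' := by
      by_contra! hc
      obtain ⟨s, hs⟩ := exists_between hcd'
      obtain ⟨r, hr1, hr2⟩ := exists_between (lt_min hc hab')
      rw [lt_min_iff] at hr2
      -- A point of the wedge with the same `t + x`; any value above `d` would do for the other
      -- coordinate.
      rcases key r ⟨hr1, hr2.2⟩ s hs r hr2.1 (d + 1) (by linarith) with h | h <;>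
        exact lt_irrefl _ h.1
    have hdd : d' ≤ d := by
      by_contra! hc
      obtain ⟨r, hr⟩ := exists_between hab'
      obtain ⟨s, hs1, hs2⟩ := exists_between (max_lt hc hcd')
      rw [max_lt_iff] at hs1
      rcases key r hr s ⟨hs1.2, hs2⟩ (a - 1) (by linarith) s hs1.1 with h | h <;>
        exact lt_irrefl _ h.2
    -- The hull in each coordinate; the corner `(a, d)` facing the left wedge stays fixed.
    refine ⟨⟨doubleCone a (max b b') (min c c') d, _, _, _, _,
      hab.trans_le (le_max_left _ _), (min_le_left _ _).trans_lt hcd, rfl⟩,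
      doubleCone_mono le_rfl (le_max_left _ _) (min_le_left _ _) le_rfl,
      doubleCone_mono haa (le_max_right _ _) (min_le_right _ _) hdd, ?_⟩
    refine (subset_causalCompl_iff (M := minkowskiPlane) (isOpen_doubleCone _ _ _ _)).2
      fun p hp q hq => Or.inr ?_
    have := minkowskiPlane_of_mem_leftWedge hab hcd _ hq
    exact (minkowskiPlane_leftOf_iff q p).2
      ⟨this.1.trans_lt hp.1.1, hp.2.2.trans_le this.2⟩
  directed_right := by
    rintro ⟨_, a, b, c, d, hab, hcd, rfl⟩ ⟨_, a', b', c', d', hab', hcd', rfl⟩ h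
    have h' := (subset_causalCompl_iff (M := minkowskiPlane)
      (isOpen_doubleCone a' b' c' d')).1 h
    have key : ∀ r ∈ Set.Ioo a' b', ∀ s ∈ Set.Ioo c' d', ∀ r' > b, ∀ s' < c,
        (r < r' ∧ s' < s) ∨ (r' < r ∧ s < s') := by
      intro r hr s hs r' hr' s' hs'
      have := h' _ (lightConePoint_mem hr hs) (lightConePoint r' s')
        (minkowskiPlane_mem_rightWedge _ (by rwa [lightConePoint_add])
          (by rwa [lightConePoint_sub]))
      rwa [minkowskiPlane_leftOf_lightConePoint, minkowskiPlane_leftOf_lightConePoint] at this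
    have hbb : b' ≤ b := by
      by_contra! hc
      obtain ⟨s, hs⟩ := exists_between hcd'
      obtain ⟨r, hr1, hr2⟩ := exists_between (max_lt hc hab')
      rw [max_lt_iff] at hr1
      rcases key r ⟨hr1.2, hr2⟩ s hs r hr1.1 (c - 1) (by linarith) with h | h <;>
        exact lt_irrefl _ h.1
    have hcc : c ≤ c' := by
      by_contra! hc
      obtain ⟨r, hr⟩ := exists_between hab'
      obtain ⟨s, hs1, hs2⟩ := exists_between (lt_min hc hcd')
      rw [lt_min_iff] at hs2
      rcases key r hr s ⟨hs1, hs2.2⟩ (b + 1) (by linarith) s hs2.1 with h | h <;>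
        exact lt_irrefl _ h.2
    refine ⟨⟨doubleCone (min a a') b c (max d d'), _, _, _, _,
      (min_le_left _ _).trans_lt hab, hcd.trans_le (le_max_left _ _), rfl⟩,
      doubleCone_mono (min_le_left _ _) le_rfl le_rfl (le_max_left _ _),
      doubleCone_mono (min_le_right _ _) hbb hcc (le_max_right _ _), ?_⟩
    refine (subset_causalCompl_iff (M := minkowskiPlane) (isOpen_doubleCone _ _ _ _)).2
      fun p hp q hq => Or.inl ?_
    have := minkowskiPlane_of_mem_rightWedge hab hcd _ hq
    exact (minkowskiPlane_leftOf_iff p q).2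
      ⟨hp.1.2.trans_le this.1, this.2.trans_lt hp.2.1⟩
  leftOf_smul := by
    intro (g : Poincare) (p : ℝ × ℝ) (q : ℝ × ℝ)
    have key : ∀ p : ℝ × ℝ, (g • p).1 + (g • p).2 = Real.exp g.s * (p.1 + p.2) + (g.a + g.b) ∧
        (g • p).1 - (g • p).2 = Real.exp (-g.s) * (p.1 - p.2) + (g.a - g.b) := by
      intro p
      change (Real.cosh g.s * p.1 + Real.sinh g.s * p.2 + g.a)
          + (Real.sinh g.s * p.1 + Real.cosh g.s * p.2 + g.b) = _ ∧
        (Real.cosh g.s * p.1 + Real.sinh g.s * p.2 + g.a)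
          - (Real.sinh g.s * p.1 + Real.cosh g.s * p.2 + g.b) = _
      rw [← Real.cosh_add_sinh, ← Real.cosh_sub_sinh]
      constructor <;> ring
    refine (minkowskiPlane_leftOf_iff _ _).trans (Iff.trans ?_ (minkowskiPlane_leftOf_iff _ _).symm)
    change (g • p).1 + (g • p).2 < (g • q).1 + (g • q).2 ∧
      (g • q).1 - (g • q).2 < (g • p).1 - (g • p).2 ↔ _
    rw [(key p).1, (key p).2, (key q).1, (key q).2]
    rw [add_lt_add_iff_right, add_lt_add_iff_right, mul_lt_mul_iff_right₀ (Real.exp_pos _),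
      mul_lt_mul_iff_right₀ (Real.exp_pos _)]
  continuous_smul := by
    intro g
    change Continuous fun p : ℝ × ℝ => (Real.cosh g.s * p.1 + Real.sinh g.s * p.2 + g.a,
      Real.sinh g.s * p.1 + Real.cosh g.s * p.2 + g.b)
    fun_prop

end Spacetime

theorem SpacetimeCase.isCausal : ∀ c : SpacetimeCase, c.spacetime.IsCausal
  | .chiral => Spacetime.lightRay_isCausal
  | .twoDim => Spacetime.minkowskiPlane_isCausal

/-! ### Algebras generated by families of local algebras -/

section Families

variable {H : Type*} [NormedAddCommGroup H] [InnerProductSpace ℂ H] [CompleteSpace H]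
  {M : Spacetime} {B : M.Region → Set (H →L[ℂ] H)} {S T : Set M.Point}

/-- A triple commutant is a single one. The adjoint clause appears because a general `S` need not be
closed under `star`. -/
theorem vnGenerated_commutant_iff {S : Set (H →L[ℂ] H)} {z : H →L[ℂ] H} :
    z ∈ (vnGenerated S).commutant ↔ ∀ b ∈ S, b * z = z * b ∧ star b * z = z * star b := by
  rw [← StarSubalgebra.mem_centralizer_iff (R := ℂ), VonNeumannAlgebra.mem_commutant_iff]
  change z ∈ Set.centralizer ((StarSubalgebra.centralizer ℂ
    (StarSubalgebra.centralizer ℂ S : Set (H →L[ℂ] H)) :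
      StarSubalgebra ℂ (H →L[ℂ] H)) : Set (H →L[ℂ] H)) ↔ _
  rw [StarSubalgebra.coe_centralizer_centralizer, Set.centralizer_centralizer_centralizer]
  rfl

/-- The commutant of `B(S)` consists of the operators commuting with all `B(O)`, `O ⊆ S`, and
their adjoints. -/
theorem mem_commutant_algebraOf {z : H →L[ℂ] H} :
    z ∈ (algebraOf B S).commutant ↔ ∀ O : M.Region, O.1 ⊆ S → ∀ b ∈ B O,
      b * z = z * b ∧ star b * z = z * star b := by
  rw [algebraOf, vnGenerated_commutant_iff]
  simp only [Set.mem_iUnion, Subtype.exists, forall_exists_index]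
  exact ⟨fun h O hO b hb => h b _ hO hb, fun h b O hO hb => h O hO b hb⟩

/-- The bicommutant property: membership in a generated algebra is tested by commutation, in place
of an approximation argument. -/
theorem mem_algebraOf {b : H →L[ℂ] H} :
    b ∈ algebraOf B S ↔ ∀ z ∈ (algebraOf B S).commutant, z * b = b * z := by
  rw [← VonNeumannAlgebra.mem_commutant_iff, VonNeumannAlgebra.commutant_commutant]

theorem subset_algebraOf {O : M.Region} (hO : O.1 ⊆ S) : B O ⊆ algebraOf B S := fun b hb =>
  mem_algebraOf.2 fun _ hz => ((mem_commutant_algebraOf.1 hz O hO b hb).1).symm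

theorem commutant_algebraOf_anti (h : S ⊆ T) :
    (algebraOf B T).commutant ≤ (algebraOf B S).commutant := fun _ hz =>
  mem_commutant_algebraOf.2 fun O hO => mem_commutant_algebraOf.1 hz O (hO.trans h)

theorem algebraOf_mono (h : S ⊆ T) : algebraOf B S ≤ algebraOf B T := fun _ hb =>
  mem_algebraOf.2 fun z hz => mem_algebraOf.1 hb z (commutant_algebraOf_anti h hz)

theorem commute_of_mem_commutant {O : M.Region} (hO : O.1 ⊆ S) {b z : H →L[ℂ] H} (hb : b ∈ B O)
    (hz : z ∈ (algebraOf B S).commutant) : b * z = z * b :=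
  (mem_commutant_algebraOf.1 hz O hO b hb).1

theorem mem_locPlus {O : M.Region} {b : H →L[ℂ] H} :
    b ∈ locPlus B O ↔ b ∈ (algebraOf B (Spacetime.leftWedge O)).commutant ∧
      b ∈ algebraOf B (Spacetime.causalCompl (Spacetime.rightWedge O)) :=
  Iff.rfl

theorem mem_locMinus {O : M.Region} {b : H →L[ℂ] H} :
    b ∈ locMinus B O ↔ b ∈ (algebraOf B (Spacetime.rightWedge O)).commutant ∧
      b ∈ algebraOf B (Spacetime.causalCompl (Spacetime.leftWedge O)) :=
  Iff.rfl

theorem isotonous_locPlus (B : M.Region → Set (H →L[ℂ] H)) : Isotonous (asSets (locPlus B)) :=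
  fun _ _ h _ hb => mem_locPlus.2
    ⟨commutant_algebraOf_anti (Spacetime.leftWedge_anti h) (mem_locPlus.1 hb).1,
      algebraOf_mono (Spacetime.causalCompl_anti (Spacetime.rightWedge_anti h))
        (mem_locPlus.1 hb).2⟩

theorem isotonous_locMinus (B : M.Region → Set (H →L[ℂ] H)) :
    Isotonous (asSets (locMinus B)) :=
  fun _ _ h _ hb => mem_locMinus.2
    ⟨commutant_algebraOf_anti (Spacetime.rightWedge_anti h) (mem_locMinus.1 hb).1,
      algebraOf_mono (Spacetime.causalCompl_anti (Spacetime.leftWedge_anti h))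
        (mem_locMinus.1 hb).2⟩

/-! ### Covariance -/

variable {U : M.Sym →* unitary (H →L[ℂ] H)}

theorem unitary_rep_inv (U : M.Sym →* unitary (H →L[ℂ] H)) (g : M.Sym) :
    (U g⁻¹ : H →L[ℂ] H) = star (U g : H →L[ℂ] H) := by
  rw [map_inv]; rfl

/-- Moves conjugation from one factor to the other, so covariance of commutants and of double
commutants can be read off from covariance of `B`. -/
theorem conj_commute_iff {u b z : H →L[ℂ] H} (hu : u ∈ unitary (H →L[ℂ] H)) :
    (u * b * star u) * z = z * (u * b * star u) ↔
      b * (star u * z * u) = (star u * z * u) * b := by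
  have h1 : star u * u = 1 := Unitary.star_mul_self_of_mem hu
  have h2 : u * star u = 1 := Unitary.mul_star_self_of_mem hu
  constructor
  · intro h
    calc b * (star u * z * u) = star u * ((u * b * star u) * z) * u := by
          simp only [mul_assoc]; rw [← mul_assoc (star u) u, h1, one_mul]
      _ = star u * (z * (u * b * star u)) * u := by rw [h]
      _ = (star u * z * u) * b := by simp only [mul_assoc]; rw [h1, mul_one]
  · intro h
    calc (u * b * star u) * z = u * (b * (star u * z * u)) * star u := by
          simp only [mul_assoc]; rw [h2, mul_one]
      _ = u * ((star u * z * u) * b) * star u := by rw [h]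
      _ = z * (u * b * star u) := by
          simp only [mul_assoc]; rw [← mul_assoc u (star u), h2, one_mul]

theorem conj_mem_commutant_algebraOf (hU : PoincareCovariant U B) (g : M.Sym)
    {z : H →L[ℂ] H} (hz : z ∈ (algebraOf B S).commutant) :
    (U g : H →L[ℂ] H) * z * star (U g : H →L[ℂ] H) ∈
      (algebraOf B ((fun p => g • p) '' S)).commutant := by
  refine mem_commutant_algebraOf.2 fun O hO b hb => ?_
  have hO' : (O.map g⁻¹).1 ⊆ S := by
    rintro _ ⟨p, hp, rfl⟩
    obtain ⟨q, hq, rfl⟩ := hO hp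
    simpa using hq
  have hb' : star (U g : H →L[ℂ] H) * b * U g ∈ B (O.map g⁻¹) := by
    rw [← hU g⁻¹ O, unitary_rep_inv, star_star]
    exact ⟨b, hb, rfl⟩
  have h := mem_commutant_algebraOf.1 hz _ hO' _ hb'
  refine ⟨((conj_commute_iff (U g).2).2 h.1.symm).symm, ((conj_commute_iff (U g).2).2 ?_).symm⟩
  have h2 := h.2.symm
  rwa [star_mul, star_mul, star_star, ← mul_assoc] at h2

theorem conj_mem_algebraOf (hU : PoincareCovariant U B) (g : M.Sym)
    {b : H →L[ℂ] H} (hb : b ∈ algebraOf B S) :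
    (U g : H →L[ℂ] H) * b * star (U g : H →L[ℂ] H) ∈ algebraOf B ((fun p => g • p) '' S) := by
  refine mem_algebraOf.2 fun z hz => ?_
  have hz' := conj_mem_commutant_algebraOf hU g⁻¹ hz
  rw [unitary_rep_inv, star_star, Set.image_image] at hz'
  simp only [inv_smul_smul, Set.image_id'] at hz'
  exact ((conj_commute_iff (U g).2).2 (mem_algebraOf.1 hb _ hz').symm).symm

/-- One inclusion for all `g` suffices: the inclusion for `g⁻¹` at the moved region is the reverse
one. -/
theorem PoincareCovariant.of_conj_mem {N : M.Region → Set (H →L[ℂ] H)}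
    (h : ∀ (g : M.Sym) (O : M.Region), ∀ b ∈ N O,
      (U g : H →L[ℂ] H) * b * star (U g : H →L[ℂ] H) ∈ N (O.map g)) :
    PoincareCovariant U N := by
  intro g O
  refine Set.Subset.antisymm (Set.image_subset_iff.2 fun b hb => h g O b hb) fun b hb => ?_
  have hb' := h g⁻¹ _ b hb
  rw [Spacetime.Region.map_inv_map, unitary_rep_inv, star_star] at hb'
  have h2 : (U g : H →L[ℂ] H) * star (U g : H →L[ℂ] H) = 1 :=
    Unitary.mul_star_self_of_mem (U g).2
  refine ⟨_, hb', ?_⟩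
  change (U g : H →L[ℂ] H) * (star (U g : H →L[ℂ] H) * b * U g) * star (U g : H →L[ℂ] H) = b
  simp only [mul_assoc]
  rw [h2, mul_one, ← mul_assoc, h2, one_mul]

theorem PoincareCovariant.locPlus (hM : M.IsCausal) (hU : PoincareCovariant U B) :
    PoincareCovariant U (asSets (locPlus B)) :=
  .of_conj_mem fun g O b hb => by
    have h1 := conj_mem_commutant_algebraOf hU g (mem_locPlus.1 hb).1
    have h2 := conj_mem_algebraOf hU g (mem_locPlus.1 hb).2
    rw [hM.image_leftWedge] at h1
    rw [hM.image_causalCompl, hM.image_rightWedge] at h2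
    exact mem_locPlus.2 ⟨h1, h2⟩

theorem PoincareCovariant.locMinus (hM : M.IsCausal) (hU : PoincareCovariant U B) :
    PoincareCovariant U (asSets (locMinus B)) :=
  .of_conj_mem fun g O b hb => by
    have h1 := conj_mem_commutant_algebraOf hU g (mem_locMinus.1 hb).1
    have h2 := conj_mem_algebraOf hU g (mem_locMinus.1 hb).2
    rw [hM.image_rightWedge] at h1
    rw [hM.image_causalCompl, hM.image_leftWedge] at h2
    exact mem_locMinus.2 ⟨h1, h2⟩

/-! ### Left and right locality -/

theorem leftLocal_locPlus (B : M.Region → Set (H →L[ℂ] H)) :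
    LeftLocal B (asSets (locPlus B)) := fun _ _ h _ hb _ hz =>
  commute_of_mem_commutant h hb (mem_locPlus.1 hz).1

theorem rightLocal_locMinus (hM : M.IsCausal) (B : M.Region → Set (H →L[ℂ] H)) :
    RightLocal B (asSets (locMinus B)) := fun _ _ h _ hz _ hb =>
  (commute_of_mem_commutant ((hM.subset_leftWedge_iff _ _).1 h) hb (mem_locMinus.1 hz).1).symm

/-- One of two separated regions is left of the other. The operator of the left region is regarded
as an element of `B`, and `B` is left-local with respect to the other. -/
theorem local_locPlus (hM : M.IsCausal) (hB : ∀ O, (locPlus B O : Set (H →L[ℂ] H)) ⊆ B O) :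
    Local (asSets (locPlus B)) := fun O₁ O₂ h b₁ hb₁ b₂ hb₂ => by
  rcases hM.subset_wedge O₁ O₂ h with h | h
  · exact leftLocal_locPlus B O₁ O₂ h b₁ (hB O₁ hb₁) b₂ hb₂
  · exact (leftLocal_locPlus B O₂ O₁ ((hM.subset_leftWedge_iff _ _).2 h) b₂ (hB O₂ hb₂) b₁
      hb₁).symm

theorem local_locMinus (hM : M.IsCausal) (hB : ∀ O, (locMinus B O : Set (H →L[ℂ] H)) ⊆ B O) :
    Local (asSets (locMinus B)) := fun O₁ O₂ h b₁ hb₁ b₂ hb₂ => by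
  rcases hM.subset_wedge O₁ O₂ h with h | h
  · exact rightLocal_locMinus hM B O₁ O₂ h b₁ hb₁ b₂ (hB O₂ hb₂)
  · exact (rightLocal_locMinus hM B O₂ O₁ ((hM.subset_leftWedge_iff _ _).2 h) b₂ hb₂ b₁
      (hB O₁ hb₁)).symm

end Families

/-! ### Local algebras of the extension -/

namespace HaagDualNet

variable {M : Spacetime} {H : Type*} [NormedAddCommGroup H] [InnerProductSpace ℂ H]
  [CompleteSpace H] {A : HaagDualNet M H}

/-! ### Haag duality and charge transporters. -/

theorem alg_le_quasilocal (A : HaagDualNet M H) (O : M.Region) :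
    (A.alg O).toStarSubalgebra ≤ A.quasilocal :=
  (le_iSup (fun O => (A.alg O).toStarSubalgebra) O).trans
    (StarSubalgebra.le_topologicalClosure _)

/-- Haag duality: an operator commuting with all observables of `O'` is localized in `O`. -/
theorem mem_alg_of_commute {O : M.Region} {b : H →L[ℂ] H}
    (h : ∀ O₁ : M.Region, O₁.1 ⊆ Spacetime.causalCompl O.1 → ∀ a : A.quasilocal,
      (a : H →L[ℂ] H) ∈ A.alg O₁ → (a : H →L[ℂ] H) * b = b * a) : b ∈ A.alg O := by
  rw [A.duality]
  refine mem_commutant_algebraOf.2 fun O₁ hO₁ a ha => ?_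
  exact ⟨h O₁ hO₁ ⟨a, A.alg_le_quasilocal O₁ ha⟩ ha,
    h O₁ hO₁ ⟨star a, A.alg_le_quasilocal O₁ (star_mem ha)⟩ (star_mem ha)⟩

theorem commute_of_mem_alg {O O₁ : M.Region} (hO : O₁.1 ⊆ Spacetime.causalCompl O.1)
    {a c : A.quasilocal} (ha : (a : H →L[ℂ] H) ∈ A.alg O₁) (hc : (c : H →L[ℂ] H) ∈ A.alg O) :
    a * c = c * a :=
  Subtype.ext (A.isLocal O₁ O hO _ ha _ hc)

theorem Transports.mono {ρ : A.quasilocal → A.quasilocal} {u : A.quasilocal} {O K : M.Region}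
    (hu : A.Transports ρ u O) (h : O.1 ⊆ K.1) : A.Transports ρ u K :=
  ⟨hu.1, fun O₁ hO₁ => hu.2 O₁ (hO₁.trans (Spacetime.causalCompl_anti h))⟩

theorem Transports.star_mul_self {ρ : A.quasilocal → A.quasilocal} {u : A.quasilocal}
    {O : M.Region} (hu : A.Transports ρ u O) : star u * u = 1 :=
  Unitary.star_mul_self_of_mem hu.1

theorem Transports.mul_star_self {ρ : A.quasilocal → A.quasilocal} {u : A.quasilocal}
    {O : M.Region} (hu : A.Transports ρ u O) : u * star u = 1 :=
  Unitary.mul_star_self_of_mem hu.1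

/-- A charge transporter to `O` implements `ρ` on the causal complement of `O`. -/
theorem Transports.mul_apply {ρ : A.quasilocal → A.quasilocal} {u : A.quasilocal}
    {O O₁ : M.Region} (hu : A.Transports ρ u O) (hO : O₁.1 ⊆ Spacetime.causalCompl O.1)
    {a : A.quasilocal} (ha : (a : H →L[ℂ] H) ∈ A.alg O₁) : u * ρ a = a * u := by
  have h : u * ρ a * star u = a := hu.2 O₁ hO a ha
  calc u * ρ a = u * ρ a * star u * u := by rw [mul_assoc, hu.star_mul_self, mul_one]
    _ = a * u := by rw [h]

theorem Transports.apply_mul_star {ρ : A.quasilocal → A.quasilocal} {u : A.quasilocal}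
    {O O₁ : M.Region} (hu : A.Transports ρ u O) (hO : O₁.1 ⊆ Spacetime.causalCompl O.1)
    {a : A.quasilocal} (ha : (a : H →L[ℂ] H) ∈ A.alg O₁) : ρ a * star u = star u * a := by
  calc ρ a * star u = star u * (u * ρ a) * star u := by
        rw [← mul_assoc, hu.star_mul_self, one_mul]
    _ = star u * a := by
        rw [hu.mul_apply hO ha, mul_assoc, mul_assoc, hu.mul_star_self, mul_one]

/-! ### Intrinsic description of the extension. -/

namespace QSystem

variable (Q : A.QSystem) {O : M.Region}

/-- An element commuting with the observables of `O'` inside the extension is carried into `A(O)`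
by every charge transporter to `O`. -/
theorem conj_mem_alg {u : A.quasilocal} (hu : A.Transports Q.θ u O) {b : H →L[ℂ] H}
    (hb : ∀ O₁ : M.Region, O₁.1 ⊆ Spacetime.causalCompl O.1 → ∀ a : A.quasilocal,
      (a : H →L[ℂ] H) ∈ A.alg O₁ → (Q.θ a : H →L[ℂ] H) * b = b * Q.θ a) :
    (u : H →L[ℂ] H) * b * star (u : H →L[ℂ] H) ∈ A.alg O := by
  refine mem_alg_of_commute fun O₁ hO₁ a ha => ?_
  have h1 : (u : H →L[ℂ] H) * Q.θ a = a * u := congrArg Subtype.val (hu.mul_apply hO₁ ha)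
  have h2 : (Q.θ a : H →L[ℂ] H) * star (u : H →L[ℂ] H) = star (u : H →L[ℂ] H) * a :=
    congrArg Subtype.val (hu.apply_mul_star hO₁ ha)
  calc (a : H →L[ℂ] H) * (u * b * star (u : H →L[ℂ] H))
      = (a * u) * b * star (u : H →L[ℂ] H) := by simp only [mul_assoc]
    _ = u * (Q.θ a * b) * star (u : H →L[ℂ] H) := by rw [← h1]; simp only [mul_assoc]
    _ = u * b * (Q.θ a * star (u : H →L[ℂ] H)) := by rw [hb O₁ hO₁ a ha]; simp only [mul_assoc]
    _ = u * b * star (u : H →L[ℂ] H) * a := by rw [h2]; simp only [mul_assoc]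

/-- The conjugate `u b u*` is in `A(O)`, and `u` is quasilocal. This is what allows `θ` to be
applied to an operator known only through von Neumann algebras. -/
theorem mem_quasilocal_of_commute {b : H →L[ℂ] H}
    (hb : ∀ O₁ : M.Region, O₁.1 ⊆ Spacetime.causalCompl O.1 → ∀ a : A.quasilocal,
      (a : H →L[ℂ] H) ∈ A.alg O₁ → (Q.θ a : H →L[ℂ] H) * b = b * Q.θ a) :
    b ∈ A.quasilocal := by
  obtain ⟨u, hu⟩ := Q.isDHR.2 O
  have h1 : star (u : H →L[ℂ] H) * u = 1 := congrArg Subtype.val hu.star_mul_self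
  have h : b = star (u : H →L[ℂ] H) * (u * b * star (u : H →L[ℂ] H)) * u := by
    simp only [mul_assoc]
    rw [h1, mul_one, ← mul_assoc, h1, one_mul]
  rw [h]
  exact mul_mem (mul_mem (star_mem u.2) (A.alg_le_quasilocal O (Q.conj_mem_alg hu hb))) u.2

/-- Intrinsic description of the local algebras of the extension: `B(O)` consists of the elements
that commute with the observables of `O'` and belong to the subfactor `θ(A) x`. -/
theorem mem_extension_iff {b : A.quasilocal} :
    (b : H →L[ℂ] H) ∈ Q.extension O ↔
      (∀ O₁ : M.Region, O₁.1 ⊆ Spacetime.causalCompl O.1 → ∀ a : A.quasilocal,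
        (a : H →L[ℂ] H) ∈ A.alg O₁ → Q.θ a * b = b * Q.θ a) ∧ Q.θ b * Q.x = Q.x * b := by
  constructor
  · rintro ⟨u, hu, a, ha, hb⟩
    obtain rfl : b = Q.θ a * (Q.θ u * Q.x) := Subtype.ext hb
    constructor
    · intro O₁ hO₁ c hc
      have h1 : c * a = a * c := commute_of_mem_alg hO₁ hc ha
      calc Q.θ c * (Q.θ a * (Q.θ u * Q.x)) = Q.θ (c * a * u) * Q.x := by
            simp only [map_mul, mul_assoc]
        _ = Q.θ (a * (u * Q.θ c)) * Q.x := by rw [hu.mul_apply hO₁ hc, h1, mul_assoc]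
        _ = Q.θ a * (Q.θ u * (Q.θ (Q.θ c) * Q.x)) := by simp only [map_mul, mul_assoc]
        _ = Q.θ a * (Q.θ u * Q.x) * Q.θ c := by rw [← Q.x_intertwines]; simp only [mul_assoc]
    · calc Q.θ (Q.θ a * (Q.θ u * Q.x)) * Q.x
          = Q.θ (Q.θ (a * u)) * (Q.θ Q.x * Q.x) := by simp only [map_mul, mul_assoc]
        _ = Q.x * Q.θ (a * u) * Q.x := by rw [← Q.associative, Q.x_intertwines, mul_assoc]
        _ = Q.x * (Q.θ a * (Q.θ u * Q.x)) := by simp only [map_mul, mul_assoc]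
  · rintro ⟨hb, hx⟩
    obtain ⟨u, hu⟩ := Q.isDHR.2 O
    -- The unit law recovers `b` from `x b = θ(b) x`: applying `θ(w*)` gives `b = θ(w* b) x`, and
    -- `u* u = 1` is then inserted.
    refine ⟨u, hu, star Q.w * b * star u, ?_, ?_⟩
    · refine mem_alg_of_commute fun O₁ hO₁ a ha => congrArg Subtype.val (?_ :
        a * (star Q.w * b * star u) = star Q.w * b * star u * a)
      have hw : star Q.w * Q.θ a = a * star Q.w := by
        have h := congrArg star (Q.w_intertwines (star a))
        simp only [star_mul, star_star, map_star] at h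
        exact h.symm
      calc a * (star Q.w * b * star u) = a * star Q.w * (b * star u) := by simp only [mul_assoc]
        _ = star Q.w * (Q.θ a * b) * star u := by rw [← hw]; simp only [mul_assoc]
        _ = star Q.w * b * (Q.θ a * star u) := by rw [hb O₁ hO₁ a ha]; simp only [mul_assoc]
        _ = star Q.w * b * star u * a := by rw [hu.apply_mul_star hO₁ ha]; simp only [mul_assoc]
    · have h1 : Q.θ (star u) * (Q.θ u * Q.x) = Q.x := by
        rw [← mul_assoc, ← map_mul, hu.star_mul_self, map_one, one_mul]
      refine congrArg Subtype.val (?_ : b = Q.θ (star Q.w * b * star u) * (Q.θ u * Q.x))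
      rw [map_mul, mul_assoc, h1, map_mul, mul_assoc, hx, ← mul_assoc, Q.unit_right, one_mul]

theorem extension_subset_quasilocal : Q.extension O ⊆ A.quasilocal := by
  rintro _ ⟨u, -, a, -, rfl⟩
  exact Subtype.mem _

theorem commute_of_mem_extension {b : H →L[ℂ] H} (hb : b ∈ Q.extension O) {O₁ : M.Region}
    (hO₁ : O₁.1 ⊆ Spacetime.causalCompl O.1) {a : A.quasilocal}
    (ha : (a : H →L[ℂ] H) ∈ A.alg O₁) : (Q.θ a : H →L[ℂ] H) * b = b * Q.θ a :=
  congrArg Subtype.val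
    ((Q.mem_extension_iff (b := ⟨b, Q.extension_subset_quasilocal hb⟩)).1 hb |>.1 O₁ hO₁ a ha)

theorem isotonous_extension : Isotonous Q.extension := by
  intro O₁ O₂ h b hb
  have hb' := (Q.mem_extension_iff (b := ⟨b, Q.extension_subset_quasilocal hb⟩)).1 hb
  exact (Q.mem_extension_iff (b := ⟨b, Q.extension_subset_quasilocal hb⟩)).2
    ⟨fun K hK => hb'.1 K (hK.trans (Spacetime.causalCompl_anti h)), hb'.2⟩

/-- The commutation condition is invariant under adjoints, but `θ(b) x = x b` is not visibly so; for
it the Frobenius relation is needed. -/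
theorem star_mem_extension {b : H →L[ℂ] H} (hb : b ∈ Q.extension O) :
    star b ∈ Q.extension O := by
  have hbq := Q.extension_subset_quasilocal hb
  obtain ⟨h1, -⟩ := (Q.mem_extension_iff (b := ⟨b, hbq⟩)).1 hb
  refine (Q.mem_extension_iff (b := star ⟨b, hbq⟩)).2 ⟨fun O₁ hO₁ a ha => ?_, ?_⟩
  · have h := congrArg star (h1 O₁ hO₁ (star a) (star_mem ha))
    simpa only [star_mul, map_star, star_star] using h.symm
  · obtain ⟨u, -, a, -, hb⟩ := hb
    obtain h : (⟨b, hbq⟩ : A.quasilocal) = Q.θ a * (Q.θ u * Q.x) := Subtype.ext hb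
    rw [h]
    calc Q.θ (star (Q.θ a * (Q.θ u * Q.x))) * Q.x
        = Q.θ (star Q.x) * (Q.θ (Q.θ (star u * star a)) * Q.x) := by
          simp only [star_mul, map_mul, map_star, mul_assoc]
      _ = Q.θ (star Q.x) * Q.x * Q.θ (star u * star a) := by
          rw [← Q.x_intertwines, mul_assoc]
      _ = Q.x * star Q.x * Q.θ (star u * star a) := by rw [Q.frobenius]
      _ = Q.x * star (Q.θ a * (Q.θ u * Q.x)) := by
          simp only [star_mul, map_mul, map_star, mul_assoc]

theorem observables_subset_extension : Q.observables O ⊆ Q.extension O := by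
  rintro _ ⟨a, ha, rfl⟩
  refine Q.mem_extension_iff.2 ⟨fun O₁ hO₁ c hc => ?_, (Q.x_intertwines a).symm⟩
  rw [← map_mul, commute_of_mem_alg hO₁ hc ha, map_mul]

theorem mem_commutant_algebraOf_extension {S : Set M.Point} {z : H →L[ℂ] H} :
    z ∈ (algebraOf Q.extension S).commutant ↔
      ∀ O : M.Region, O.1 ⊆ S → ∀ b ∈ Q.extension O, b * z = z * b := by
  rw [mem_commutant_algebraOf]
  exact ⟨fun h O hO b hb => (h O hO b hb).1, fun h O hO b hb =>
    ⟨h O hO b hb, h O hO _ (Q.star_mem_extension hb)⟩⟩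

/-- Observables localized in `O` commute with the extension on the causal complement. -/
theorem observables_subset_commutant (hM : M.IsCausal) {S : Set M.Point}
    (hS : S ⊆ Spacetime.causalCompl O.1) :
    Q.observables O ⊆ (algebraOf Q.extension S).commutant := by
  rintro _ ⟨a, ha, rfl⟩
  refine Q.mem_commutant_algebraOf_extension.2 fun O₁ hO₁ b hb => ?_
  exact (Q.commute_of_mem_extension hb ((Spacetime.subset_causalCompl_comm (hM.isOpen_region O₁)
    (hM.isOpen_region O)).1 (hO₁.trans hS)) ha).symm

/-- Let `u` transport `θ` to `O`, and let `v` transport it to a region of the causal complement of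
`O`. Then an element commuting with the observables of `O'` belongs to `θ(A) x` if and only if it
commutes with `u* v θ(u) x`. -/
theorem apply_mul_x_iff {R : M.Region} {u v b : A.quasilocal} (hu : A.Transports Q.θ u O)
    (hv : A.Transports Q.θ v R) (hR : O.1 ⊆ Spacetime.causalCompl R.1)
    (hb : ∀ O₁ : M.Region, O₁.1 ⊆ Spacetime.causalCompl O.1 → ∀ a : A.quasilocal,
      (a : H →L[ℂ] H) ∈ A.alg O₁ → (Q.θ a : H →L[ℂ] H) * b = b * Q.θ a) :
    Q.θ b * Q.x = Q.x * b ↔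
      b * (star u * v * Q.θ u * Q.x) = star u * v * Q.θ u * Q.x * b := by
  have hc : ((u * b * star u : A.quasilocal) : H →L[ℂ] H) ∈ A.alg O := Q.conj_mem_alg hu hb
  -- Since `u b u*` lies in `A(O)` and `v` is localized away from `O`, `v` turns `θ(u b u*)` into `u
  -- b u*`; so `u* v θ(u)` intertwines `θ(b)` with `b`.
  have hθ : star u * v * Q.θ u * Q.θ b = b * (star u * v * Q.θ u) := by
    have hub : u * b = (u * b * star u) * u := by
      rw [mul_assoc, hu.star_mul_self, mul_one]
    calc star u * v * Q.θ u * Q.θ b = star u * v * Q.θ (u * b) := by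
          rw [map_mul, mul_assoc]
      _ = star u * (v * Q.θ (u * b * star u)) * Q.θ u := by
          conv_lhs => rw [hub, map_mul]
          simp only [mul_assoc]
      _ = star u * ((u * b * star u) * v) * Q.θ u := by rw [hv.mul_apply hR hc]
      _ = (star u * u) * b * (star u * v * Q.θ u) := by simp only [mul_assoc]
      _ = b * (star u * v * Q.θ u) := by rw [hu.star_mul_self, one_mul]
  -- A left inverse, to cancel the intertwiner in the converse direction.
  have hz : Q.θ (star u) * star v * u * (star u * v * Q.θ u) = 1 := by
    calc _ = Q.θ (star u) * (star v * ((u * star u) * v)) * Q.θ u := by simp only [mul_assoc]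
      _ = 1 := by
        rw [hu.mul_star_self, one_mul, hv.star_mul_self, mul_one, ← map_mul, hu.star_mul_self,
          map_one]
  rw [← mul_assoc b, ← hθ, mul_assoc _ Q.x b, mul_assoc _ (Q.θ b) Q.x]
  refine ⟨fun h => by rw [h], fun h => ?_⟩
  have := congrArg (Q.θ (star u) * star v * u * ·) h
  simpa only [← mul_assoc _ (star u * v * Q.θ u), hz, one_mul] using this

/-- If `W₁` and `W₂` are the two sides of `O`, then `B(W₁)' ∩ B(W₂') ⊆ B(O)`. -/
theorem relative_commutant_subset_extension (hM : M.IsCausal) {W₁ W₂ : Set M.Point}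
    (hW : ∀ O₁ : M.Region, O₁.1 ⊆ Spacetime.causalCompl O.1 → O₁.1 ⊆ W₁ ∨ O₁.1 ⊆ W₂)
    (hO : O.1 ⊆ Spacetime.causalCompl W₂)
    (hR : ∃ R : M.Region, R.1 ⊆ W₂)
    (hdir : ∀ P : M.Region, P.1 ⊆ Spacetime.causalCompl W₂ →
      ∃ K : M.Region, O.1 ⊆ K.1 ∧ P.1 ⊆ K.1 ∧ K.1 ⊆ Spacetime.causalCompl W₂)
    {b : H →L[ℂ] H} (hb₁ : b ∈ (algebraOf Q.extension W₁).commutant)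
    (hb₂ : b ∈ algebraOf Q.extension (Spacetime.causalCompl W₂)) : b ∈ Q.extension O := by
  have hcomm : ∀ O₁ : M.Region, O₁.1 ⊆ Spacetime.causalCompl O.1 → ∀ a : A.quasilocal,
      (a : H →L[ℂ] H) ∈ A.alg O₁ → (Q.θ a : H →L[ℂ] H) * b = b * Q.θ a := by
    intro O₁ hO₁ a ha
    rcases hW O₁ hO₁ with h | h
    · exact Q.mem_commutant_algebraOf_extension.1 hb₁ O₁ h _
        (Q.observables_subset_extension ⟨a, ha, rfl⟩)
    · refine mem_algebraOf.1 hb₂ _ (Q.observables_subset_commutant hM ?_ ⟨a, ha, rfl⟩)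
      exact Spacetime.causalCompl_anti h
  obtain ⟨R, hR⟩ := hR
  obtain ⟨u, hu⟩ := Q.isDHR.2 O
  obtain ⟨v, hv⟩ := Q.isDHR.2 R
  -- The operator is built from `O` and `R` alone, yet must commute with `B(P)` for every `P ⊆ W₂'`.
  -- Enlarging `P` to a `K` containing `O` works because `u` also transports `θ` to `K`, while `R`
  -- stays separated from `K`.
  have hz : ((star u * v * Q.θ u * Q.x : A.quasilocal) : H →L[ℂ] H) ∈
      (algebraOf Q.extension (Spacetime.causalCompl W₂)).commutant := by
    refine Q.mem_commutant_algebraOf_extension.2 fun P hP y hy => ?_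
    obtain ⟨K, hOK, hPK, hK⟩ := hdir P hP
    have hyK := Q.isotonous_extension P K hPK hy
    have hyq := Q.extension_subset_quasilocal hyK
    exact congrArg Subtype.val ((Q.apply_mul_x_iff (b := ⟨y, hyq⟩) (hu.mono hOK) hv
      (hK.trans (Spacetime.causalCompl_anti hR))
      fun O₁ hO₁ a ha => Q.commute_of_mem_extension hyK hO₁ ha).1
      ((Q.mem_extension_iff (b := ⟨y, hyq⟩)).1 hyK).2)
  have hbq := Q.mem_quasilocal_of_commute hcomm
  refine (Q.mem_extension_iff (b := ⟨b, hbq⟩)).2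
    ⟨fun O₁ hO₁ a ha => Subtype.ext (hcomm O₁ hO₁ a ha), ?_⟩
  exact (Q.apply_mul_x_iff (b := ⟨b, hbq⟩) hu hv (hO.trans (Spacetime.causalCompl_anti hR))
    hcomm).2 (Subtype.ext (mem_algebraOf.1 hb₂ _ hz).symm)

/-! ### Relative commutants, intermediate nets and maximality. -/

theorem locPlus_subset_extension (hM : M.IsCausal) (O : M.Region) :
    (locPlus Q.extension O : Set (H →L[ℂ] H)) ⊆ Q.extension O := fun _ hb =>
  Q.relative_commutant_subset_extension hM (fun O₁ => hM.subset_wedge O₁ O)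
    (hM.subset_compl_rightWedge O) (hM.exists_right O) (hM.directed_right O)
    (mem_locPlus.1 hb).1 (mem_locPlus.1 hb).2

theorem locMinus_subset_extension (hM : M.IsCausal) (O : M.Region) :
    (locMinus Q.extension O : Set (H →L[ℂ] H)) ⊆ Q.extension O := fun _ hb =>
  Q.relative_commutant_subset_extension hM (fun O₁ h => (hM.subset_wedge O₁ O h).symm)
    (hM.subset_compl_leftWedge O) (hM.exists_left O) (hM.directed_left O)
    (mem_locMinus.1 hb).1 (mem_locMinus.1 hb).2

theorem locPlus_eq (hM : M.IsCausal) (O : M.Region) :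
    (locPlus Q.extension O : Set (H →L[ℂ] H)) =
      ((algebraOf Q.extension (Spacetime.leftWedge O)).commutant : Set (H →L[ℂ] H)) ∩
        Q.extension O :=
  Set.Subset.antisymm (fun _ hb => ⟨(mem_locPlus.1 hb).1, Q.locPlus_subset_extension hM O hb⟩)
    fun _ hb => mem_locPlus.2 ⟨hb.1, subset_algebraOf (hM.subset_compl_rightWedge O) hb.2⟩

theorem locMinus_eq (hM : M.IsCausal) (O : M.Region) :
    (locMinus Q.extension O : Set (H →L[ℂ] H)) =
      ((algebraOf Q.extension (Spacetime.rightWedge O)).commutant : Set (H →L[ℂ] H)) ∩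
        Q.extension O :=
  Set.Subset.antisymm (fun _ hb => ⟨(mem_locMinus.1 hb).1, Q.locMinus_subset_extension hM O hb⟩)
    fun _ hb => mem_locMinus.2 ⟨hb.1, subset_algebraOf (hM.subset_compl_leftWedge O) hb.2⟩

theorem intermediate_locPlus (hM : M.IsCausal) :
    Intermediate Q.observables Q.extension (locPlus Q.extension) := fun O =>
  ⟨by
    rw [Q.locPlus_eq hM]
    exact Set.subset_inter (Q.observables_subset_commutant hM
      (Spacetime.leftWedge_subset_causalCompl O)) Q.observables_subset_extension,
    Q.locPlus_subset_extension hM O⟩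

theorem intermediate_locMinus (hM : M.IsCausal) :
    Intermediate Q.observables Q.extension (locMinus Q.extension) := fun O =>
  ⟨by
    rw [Q.locMinus_eq hM]
    exact Set.subset_inter (Q.observables_subset_commutant hM
      (Spacetime.rightWedge_subset_causalCompl O)) Q.observables_subset_extension,
    Q.locMinus_subset_extension hM O⟩

theorem le_locPlus (hM : M.IsCausal) {N : M.Region → VonNeumannAlgebra H}
    (hN : Intermediate Q.observables Q.extension N) (h : LeftLocal Q.extension (asSets N))
    (O : M.Region) : N O ≤ locPlus Q.extension O := fun n hn => by
  rw [← SetLike.mem_coe, Q.locPlus_eq hM]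
  exact ⟨Q.mem_commutant_algebraOf_extension.2 fun O₁ hO₁ b hb => h O₁ O hO₁ b hb n hn,
    (hN O).2 hn⟩

theorem le_locMinus (hM : M.IsCausal) {N : M.Region → VonNeumannAlgebra H}
    (hN : Intermediate Q.observables Q.extension N) (h : RightLocal Q.extension (asSets N))
    (O : M.Region) : N O ≤ locMinus Q.extension O := fun n hn => by
  rw [← SetLike.mem_coe, Q.locMinus_eq hM]
  exact ⟨Q.mem_commutant_algebraOf_extension.2 fun O₁ hO₁ b hb =>
    (h O O₁ ((hM.subset_leftWedge_iff _ _).2 hO₁) n hn b hb).symm, (hN O).2 hn⟩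

end QSystem

end HaagDualNet

theorem lemma4p6 (c : SpacetimeCase) {H : Type*} [NormedAddCommGroup H] [InnerProductSpace ℂ H]
    [CompleteSpace H] (A : HaagDualNet c.spacetime H) (Q : A.QSystem) :
    -- (i) isotonous and Poincaré covariant nets of von Neumann algebras
    (Isotonous (asSets (locPlus Q.extension)) ∧ Isotonous (asSets (locMinus Q.extension)) ∧
      ∀ U : c.spacetime.Sym →* unitary (H →L[ℂ] H), PoincareCovariant U Q.extension →
        PoincareCovariant U (asSets (locPlus Q.extension)) ∧
        PoincareCovariant U (asSets (locMinus Q.extension))) ∧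
    -- (ii) left and right locality
    (LeftLocal Q.extension (asSets (locPlus Q.extension)) ∧
      RightLocal Q.extension (asSets (locMinus Q.extension)) ∧
      RightLocal (asSets (locPlus Q.extension)) Q.extension ∧
      LeftLocal (asSets (locMinus Q.extension)) Q.extension) ∧
    -- (iii) local, intermediate, and given by relative commutants in `B(O)`
    (Local (asSets (locPlus Q.extension)) ∧ Local (asSets (locMinus Q.extension)) ∧
      Intermediate Q.observables Q.extension (locPlus Q.extension) ∧
      Intermediate Q.observables Q.extension (locMinus Q.extension) ∧
      ∀ O : c.spacetime.Region,
        (locPlus Q.extension O : Set (H →L[ℂ] H)) =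
          ((algebraOf Q.extension (Spacetime.leftWedge O)).commutant : Set (H →L[ℂ] H)) ∩
            Q.extension O ∧
        (locMinus Q.extension O : Set (H →L[ℂ] H)) =
          ((algebraOf Q.extension (Spacetime.rightWedge O)).commutant : Set (H →L[ℂ] H)) ∩
            Q.extension O) ∧
    -- (iv) maximality among all intermediate families with the property in (ii)
    (∀ N : c.spacetime.Region → VonNeumannAlgebra H,
      Intermediate Q.observables Q.extension N →
        (LeftLocal Q.extension (asSets N) → ∀ O, N O ≤ locPlus Q.extension O) ∧
        (RightLocal Q.extension (asSets N) → ∀ O, N O ≤ locMinus Q.extension O)) := by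
  have hM := c.isCausal
  exact ⟨⟨isotonous_locPlus _, isotonous_locMinus _, fun _ hU => ⟨hU.locPlus hM, hU.locMinus hM⟩⟩,
    -- `RightLocal` is `LeftLocal` with its arguments exchanged, so the equivalent forms have the
    -- same proofs.
    ⟨leftLocal_locPlus _, rightLocal_locMinus hM _, leftLocal_locPlus _,
      rightLocal_locMinus hM _⟩,
    ⟨local_locPlus hM (Q.locPlus_subset_extension hM),
      local_locMinus hM (Q.locMinus_subset_extension hM),
      Q.intermediate_locPlus hM, Q.intermediate_locMinus hM,
      fun O => ⟨Q.locPlus_eq hM O, Q.locMinus_eq hM O⟩⟩,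
    fun _ hN => ⟨Q.le_locPlus hM hN, Q.le_locMinus hM hN⟩⟩
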